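/- **Theorem (Equivalence of Corrections).** Let $U:\mathbb R^d\to\mathbb R^d$ be $C^2$ and globally Lipschitz, with symmetric Jacobian $J_U=J_U^T$. For a step size $\eta>0$ put $\Phi^U_\eta(\theta)=\theta-\eta U(\theta)$. Throughout, $O(\eta^m)$ refers to $\eta\to0^+$ and is uniform for $\theta$ in compact sets. Consider families of functions $\phi=(\phi_\eta)_{\eta>0}$ on $\mathbb R^d$, and call $\phi$ * a *discretization error potential* (DE) if each $\phi_\eta$ is $C^2$, $\nabla\phi_\eta$ and its first derivative are $O(\eta)$, and for every fixed $N$ and all sufficiently small $\eta$ (locally uniformly in $\theta$) the solution of $\dot\gamma=-\eta\,(U+\nabla\phi_\eta)(\gamma)$, $\gamma(0)=\theta$, exists on $[0,N]$ and satisfies $(\Phi^U_\eta)^{t}(\theta)=\gamma(t)+O(\eta^3)$ for $t=0,1,\dots,N$; * a *time reversal asymmetry potential* (TA) if each $\phi_\eta$ is differentiable and $2\eta\nabla\phi_\eta(\theta)=\theta-\tilde\theta+O(\eta^3)$, where $\tilde\theta=\theta-\eta U(\theta)+\eta U(\Phi^U_\eta(\theta))$ is the state recovered by a forward and then a backward step;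 * a *time renormalization potential* (TR) of a refinement $(U_k)_{k\ge0}$ of $U$ if each $\phi_\eta$ is differentiable and, locally uniformly for small $\eta$, the limit $U_\infty=\lim_{k\to\infty}U_k$ exists and $U_\infty=U+\nabla\phi_\eta+O(\eta^2)$. Here a *refinement* is a family of differentiable fields $U_k=U_{k}^{(\eta)}$ with $U_0=U$, such that $U_k-U$ and its first derivative are $O(\eta)$ uniformly in $k$ and, with $\eta_k=\eta/2^k$, $\Phi^{U_{k+1}}_{\eta_{k+1}}\circ\Phi^{U_{k+1}}_{\eta_{k+1}}=\Phi^{U_k}_{\eta_k}+O(\eta_k^3)$ uniformly in $k$; * a *stochastic entropy potential* (ST) if for all $\eta>0$ and $\mu\in\mathbb R^d$ the iterated limit $\lim_{\tau\to0}\lim_{\sigma\to0}\sigma^2\,\mathbb E[\Delta S_{\rm tot}]$ exists and equals $8\eta\,\phi_\eta(\mu)+O(\eta^3)$. Here $\theta_k\sim\mathcal N(\mu,\tau I)$, $\theta_{k+1}=\theta_k-\eta U(\theta_k)+\sigma\varepsilon$ with an independent $\varepsilon\sim\mathcal N(0,I)$, and $\Delta S_{\rm tot}=\Delta S_{\rm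 bath}+\Delta S_{\rm sys}$, where $\Delta S_{\rm bath}=\ln\frac{p(\theta_{k+1}|\theta_k)}{p(\theta_k|\theta_{k+1})}$ with $p(\cdot|\cdot)$ the transition density, and $\Delta S_{\rm sys}$ is the Shannon (differential) entropy of the law of $\theta_{k+1}$ minus that of $\theta_k$; all these expectations are required to converge. Then $U$ has a refinement, even one all of whose fields have symmetric Jacobian. For each $X\in\{\mathrm{DE},\mathrm{TA},\mathrm{TR},\mathrm{ST}\}$ (for TR: for every refinement of $U$) the function $\frac{\eta}{4}\|U(\theta)\|^2$ is a potential of type $X$, and every potential $\phi_X$ of type $X$ satisfies $$\phi_{X,\eta}(\theta)=\frac{\eta}{4}\|U(\theta)\|^2+O(\eta^2),$$ where for $X\in\{\mathrm{DE},\mathrm{TA},\mathrm{TR}\}$, whose definition involves only $\nabla\phi_X$, this holds after adding to $\phi_{X,\eta}$ a suitable constant depending only on $\eta$. Moreover, integrating the exact time-asymmetry force along the straight segment from any fixed reference point $\theta_{\rm ref}$ gives $$\int_0^1\frac{\vartheta_s-\tilde\vartheta_s}{2\eta}\cdot(\theta-\theta_{\rm ref})\,ds=\frac\eta4\|U(\theta)\|^2-\frac\eta4\|U(\theta_{\rm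 ref})\|^2+O(\eta^2),\qquad \vartheta_s=\theta_{\rm ref}+s(\theta-\theta_{\rm ref}).$$ -/

import Mathlib

open Filter Topology MeasureTheory

noncomputable section

namespace Irrev

/-- Parameter space `ℝ^d` with the Euclidean norm. -/
abbrev Param (d : ℕ) : Type := EuclideanSpace ℝ (Fin d)

variable {d : ℕ}

/-- The Jacobian of `U` is symmetric at every point. -/
def SymmetricJacobian (U : Param d → Param d) : Prop :=
  ∀ θ, (fderiv ℝ U θ : Param d →ₗ[ℝ] Param d).IsSymmetric

/-- `r η θ = O(η^m)` as `η → 0⁺`, locally uniformly in `θ`. -/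
def LocO {F : Type*} [Norm F] (m : ℕ) (r : ℝ → Param d → F) : Prop :=
  ∀ K : Set (Param d), IsCompact K → ∃ C η₀ : ℝ, 0 < η₀ ∧
    ∀ η : ℝ, 0 < η → η < η₀ → ∀ θ ∈ K, ‖r η θ‖ ≤ C * η ^ m

/-- The leading-order potential `(η/4) ‖U(θ)‖²`. -/
def leading (U : Param d → Param d) (η : ℝ) (θ : Param d) : ℝ :=
  η / 4 * ‖U θ‖ ^ 2

/-- `φ_η(θ) = (η/4) ‖U(θ)‖² + O(η²)`. -/
def EqLeading (U : Param d → Param d) (φ : ℝ → Param d → ℝ) : Prop :=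
  LocO 2 fun η θ => φ η θ - leading U η θ

/-- `φ_η(θ) = (η/4) ‖U(θ)‖² + O(η²)` once the additive constant of `φ_η`, which a condition on
`∇φ_η` leaves free, is chosen suitably. -/
def EqLeadingUpToConst (U : Param d → Param d) (φ : ℝ → Param d → ℝ) : Prop :=
  ∃ c : ℝ → ℝ, EqLeading U fun η θ => φ η θ + c η

/-- The discrete update `θ ↦ θ - η U(θ)`. -/
def update (U : Param d → Param d) (η : ℝ) (θ : Param d) : Param d :=
  θ - η • U θ

/-! ### Discretization error -/

/-- `γ` solves `γ' = -η V(γ)`, `γ(0) = θ` on `[0, T]`. -/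
def IsFlowLine (V : Param d → Param d) (η T : ℝ) (θ : Param d) (γ : ℝ → Param d) : Prop :=
  γ 0 = θ ∧ ∀ s ∈ Set.Icc (0 : ℝ) T, HasDerivWithinAt γ (-(η • V (γ s))) (Set.Icc 0 T) s

/-- `φ` is a discretization error potential: the correction `∇φ_η` is `O(η)` (with its first
derivative), and the flow of `U + ∇φ_η` follows the discrete iterates to the order `O(η³)`, one
order better than the flow of `U`, over every fixed number `N` of iterations. -/
structure IsDEPotential (U : Param d → Param d) (φ : ℝ → Param d → ℝ) : Prop where
  smooth : ∀ η : ℝ, 0 < η → ContDiff ℝ 2 (φ η)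
  force_small : LocO 1 fun η θ => gradient (φ η) θ
  deriv_small : LocO 1 fun η θ => fderiv ℝ (gradient (φ η)) θ
  matching : ∀ N : ℕ, ∀ K : Set (Param d), IsCompact K → ∃ C η₀ : ℝ, 0 < η₀ ∧
    ∀ η : ℝ, 0 < η → η < η₀ → ∀ θ ∈ K, ∃ γ : ℝ → Param d,
      IsFlowLine (fun x => U x + gradient (φ η) x) η N θ γ ∧
      ∀ t : ℕ, t ≤ N → ‖(update U η)^[t] θ - γ t‖ ≤ C * η ^ 3

/-! ### Time reversal asymmetry -/

/-- The state recovered by a forward step followed by a backward step. -/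
def recovered (U : Param d → Param d) (η : ℝ) (θ : Param d) : Param d :=
  θ - η • U θ + η • U (update U η θ)

/-- `φ` is a time reversal asymmetry potential: `2η ∇φ_η(θ) = θ - θ̃ + O(η³)`. The residual
`θ - θ̃` is in general a gradient only to leading order, hence the remainder. -/
structure IsTAPotential (U : Param d → Param d) (φ : ℝ → Param d → ℝ) : Prop where
  smooth : ∀ η : ℝ, 0 < η → Differentiable ℝ (φ η)
  force : LocO 3 fun η θ => (2 * η) • gradient (φ η) θ - (θ - recovered U η θ)

/-- The time asymmetry potential rebuilt from the exact force `(θ - θ̃)/(2η)` by integration along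
the straight segment from the reference point `θref` to `θ`. -/
def taLinePotential (U : Param d → Param d) (θref : Param d) (η : ℝ) (θ : Param d) : ℝ :=
  ∫ s in (0 : ℝ)..1,
    inner ℝ ((2 * η)⁻¹ • ((θref + s • (θ - θref)) - recovered U η (θref + s • (θ - θref))))
      (θ - θref)

/-! ### Time renormalization -/

/-- `V η k` is the field `U_k` at step size `η_k = η / 2^k` of a refinement of `U = U_0`: two steps
of `U_{k+1}` at `η_{k+1}` reproduce one step of `U_k` at `η_k` with local error `O(η_k³)`, uniformly
over the scales `k`. The corrections `U_k - U` are `O(η)` with their first derivatives. -/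
structure IsRefinement (U : Param d → Param d) (V : ℝ → ℕ → Param d → Param d) : Prop where
  zero : ∀ η : ℝ, 0 < η → V η 0 = U
  smooth : ∀ η : ℝ, 0 < η → ∀ k, Differentiable ℝ (V η k)
  small : ∀ K : Set (Param d), IsCompact K → ∃ C η₀ : ℝ, 0 < η₀ ∧
    ∀ η : ℝ, 0 < η → η < η₀ → ∀ k, ∀ θ ∈ K,
      ‖V η k θ - U θ‖ ≤ C * η ∧ ‖fderiv ℝ (V η k) θ - fderiv ℝ U θ‖ ≤ C * η
  consistent : ∀ K : Set (Param d), IsCompact K → ∃ C η₀ : ℝ, 0 < η₀ ∧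
    ∀ η : ℝ, 0 < η → η < η₀ → ∀ k, ∀ θ ∈ K,
      ‖update (V η (k + 1)) (η / 2 ^ (k + 1)) (update (V η (k + 1)) (η / 2 ^ (k + 1)) θ)
        - update (V η k) (η / 2 ^ k) θ‖ ≤ C * (η / 2 ^ k) ^ 3

/-- `φ` is the time renormalization potential of the refinement `V`: the continuous limit
`U_∞ = lim_k U_k` exists and `U_∞ = U + ∇φ_η + O(η²)`. -/
structure IsTRPotential (U : Param d → Param d) (V : ℝ → ℕ → Param d → Param d)
    (φ : ℝ → Param d → ℝ) : Prop where
  smooth : ∀ η : ℝ, 0 < η → Differentiable ℝ (φ η)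
  limit : ∀ K : Set (Param d), IsCompact K → ∃ C η₀ : ℝ, 0 < η₀ ∧
    ∀ η : ℝ, 0 < η → η < η₀ → ∀ θ ∈ K, ∃ W : Param d,
      Tendsto (fun k => V η k θ) atTop (𝓝 W) ∧
      ‖W - (U θ + gradient (φ η) θ)‖ ≤ C * η ^ 2

/-! ### Stochastic entropy -/

/-- Density of `N(m, v I)` on `ℝ^d`. -/
def gaussDensity (m : Param d) (v : ℝ) (x : Param d) : ℝ :=
  (2 * Real.pi * v) ^ (-(d : ℝ) / 2) * Real.exp (-‖x - m‖ ^ 2 / (2 * v))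

/-- The law `N(m, v I)` on `ℝ^d`. -/
def gauss (m : Param d) (v : ℝ) : Measure (Param d) :=
  volume.withDensity fun x => ENNReal.ofReal (gaussDensity m v x)

/-- Transition density `p(θ' | θ)` of `θ' = θ - η U(θ) + σ ε`, `ε ∼ N(0, I)`. -/
def transition (U : Param d → Param d) (η σ : ℝ) (θ' θ : Param d) : ℝ :=
  gaussDensity (update U η θ) (σ ^ 2) θ'

/-- The noisy update as a function of the pair `(θ, ε)`. -/
def noisyUpdate (U : Param d → Param d) (η σ : ℝ) (z : Param d × Param d) : Param d :=
  update U η z.1 + σ • z.2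

/-- Joint law of `(θ_k, ε_k)`: independent, `θ_k ∼ N(μ, τ I)` and `ε_k ∼ N(0, I)`. -/
def jointLaw (μ : Param d) (τ : ℝ) : Measure (Param d × Param d) :=
  (gauss μ τ).prod (gauss 0 1)

/-- Law of `θ_{k+1}`. -/
def nextLaw (U : Param d → Param d) (η σ : ℝ) (μ : Param d) (τ : ℝ) : Measure (Param d) :=
  (jointLaw μ τ).map (noisyUpdate U η σ)

/-- Entropy change of the bath, `log (p(θ_{k+1} | θ_k) / p(θ_k | θ_{k+1}))`. -/
def bathEntropy (U : Param d → Param d) (η σ : ℝ) (z : Param d × Param d) : ℝ :=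
  Real.log (transition U η σ (noisyUpdate U η σ z) z.1 /
    transition U η σ z.1 (noisyUpdate U η σ z))

/-- The log-density of a law with respect to Lebesgue measure. -/
def logDensity (ν : Measure (Param d)) (x : Param d) : ℝ :=
  Real.log (ν.rnDeriv volume x).toReal

/-- Shannon (differential) entropy. -/
def shannon (ν : Measure (Param d)) : ℝ :=
  -∫ x, logDensity ν x ∂ν

/-- `𝔼[ΔS_tot] = 𝔼[ΔS_bath] + ΔS_sys`, with `ΔS_sys` the change of the Shannon entropy. -/
def meanTotalEntropy (U : Param d → Param d) (η σ : ℝ) (μ : Param d) (τ : ℝ) : ℝ :=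
  (∫ z, bathEntropy U η σ z ∂(jointLaw μ τ)) +
    (shannon (nextLaw U η σ μ τ) - shannon (gauss μ τ))

/-- The expectations that enter `meanTotalEntropy` are those of honest (absolutely continuous)
probability laws and converge. -/
structure EntropyWellDefined (U : Param d → Param d) (η σ : ℝ) (μ : Param d) (τ : ℝ) : Prop where
  init_prob : IsProbabilityMeasure (gauss μ τ)
  next_prob : IsProbabilityMeasure (nextLaw U η σ μ τ)
  next_ac : nextLaw U η σ μ τ ≪ volume
  bath : Integrable (bathEntropy U η σ) (jointLaw μ τ)
  sys_init : Integrable (logDensity (gauss μ τ)) (gauss μ τ)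
  sys_next : Integrable (logDensity (nextLaw U η σ μ τ)) (nextLaw U η σ μ τ)

/-- `lim_{τ → 0} lim_{σ → 0} σ² 𝔼[ΔS_tot] = L`. -/
def HasScaledEntropyProduction (U : Param d → Param d) (η : ℝ) (μ : Param d) (L : ℝ) : Prop :=
  (∀ τ σ : ℝ, 0 < τ → 0 < σ → EntropyWellDefined U η σ μ τ) ∧
  ∃ l : ℝ → ℝ,
    (∀ τ : ℝ, 0 < τ →
      Tendsto (fun σ : ℝ => σ ^ 2 * meanTotalEntropy U η σ μ τ) (𝓝[>] 0) (𝓝 (l τ))) ∧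
    Tendsto l (𝓝[>] 0) (𝓝 L)

/-- `φ` is a stochastic entropy potential: the scaled entropy production
`lim_{τ → 0} lim_{σ → 0} σ² 𝔼[ΔS_tot]` exists and equals `8η φ_η(μ) + O(η³)`. -/
def IsSTPotential (U : Param d → Param d) (φ : ℝ → Param d → ℝ) : Prop :=
  ∃ L : ℝ → Param d → ℝ,
    (∀ η : ℝ, 0 < η → ∀ μ, HasScaledEntropyProduction U η μ (L η μ)) ∧
    LocO 3 fun η μ => L η μ - 8 * η * φ η μ

end Irrev

end

open Filter Topology MeasureTheory

noncomputable section

namespace Irrev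

variable {d : ℕ}


/-! Write G for `selfForce U`, that is J_U U. Symmetry of J_U makes G the gradient of ‖U‖²/2, so the
gradient of `leading U η` is (η/2)G (`hasGradientAt_leading`). The three force-based notions each
say that ∇φ_η = (η/2)G + O(η²), and integrating this over a ball gives the claim up to a constant
(`eqLeadingUpToConst_of_gradient`).

Time reversal: θ - θ̃ = η(U(θ) - U(θ - ηU(θ))) = η²G + O(η³) by Taylor (`recovered_expansion`).
Discretization: the time-one flow of U + P with P = O(η) is θ - ηU - ηP + (η²/2)G + O(η³), and it
agrees with the Euler step exactly when P cancels the quadratic term (`IsFlowLine.expansion`). Over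
N steps the local errors are propagated by the Lipschitz map `update U η`. Renormalization:
consistency of scales forces U_{k+1} - U_k = (η_{k+1}/2)G up to an error summable in k, and the
geometric series adds up to (η/2)G (`IsRefinement.step`, `IsRefinement.limit`).

Stochastic entropy: σ² times the bath entropy is an explicit quadratic expression tending to
½‖η(U(θ) + U(Φθ))‖² = 2η²‖U‖² + O(η³), where Φ is the Euler step (`sq_mul_bathEntropy`,
`bathLimit_expansion`). The Shannon entropies grow at most like |log σ|, so the factor σ² removes
them (`tendsto_sq_mul_shannon_nextLaw`).

A symmetric refinement comes from W = U ∘ (id + cW). As c varies this W solves the Burgers equation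
∂_c W = J_W W, the infinitesimal form of the renormalization step (`exists_symmetric_refinement`).
-/

/-- The field `J_U U`, which is the gradient of `‖U‖² / 2` when `J_U` is symmetric. -/
def selfForce (U : Param d → Param d) (θ : Param d) : Param d :=
  fderiv ℝ U θ (U θ)

/-- Bounds for a `C²` field, up to second order, on the ball of radius `R`. -/
structure LocalBounds (U : Param d → Param d) (R B : ℝ) : Prop where
  one_le : 1 ≤ B
  norm_le : ∀ x, ‖x‖ ≤ R → ‖U x‖ ≤ B
  fderiv_le : ∀ x, ‖x‖ ≤ R → ‖fderiv ℝ U x‖ ≤ B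
  fderiv_lip : ∀ x y, ‖x‖ ≤ R → ‖y‖ ≤ R → ‖fderiv ℝ U y - fderiv ℝ U x‖ ≤ B * ‖y - x‖
  lip : ∀ x y, ‖x‖ ≤ R → ‖y‖ ≤ R → ‖U y - U x‖ ≤ B * ‖y - x‖
  taylor : ∀ x y, ‖x‖ ≤ R → ‖y‖ ≤ R →
    ‖U y - U x - fderiv ℝ U x (y - x)‖ ≤ B * ‖y - x‖ ^ 2

/-! ### Uniform bounds on balls and the calculus of `LocO`. -/

lemma exists_bound_on_ball {F : Type*} [NormedAddCommGroup F] {f : Param d → F}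
    (hf : Continuous f) (R : ℝ) : ∃ C, ∀ x, ‖x‖ ≤ R → ‖f x‖ ≤ C := by
  obtain ⟨C, hC⟩ := (isCompact_closedBall (0 : Param d) R).exists_bound_of_continuousOn
    hf.continuousOn
  exact ⟨C, fun x hx => hC x (by simpa using hx)⟩

lemma exists_localBounds {U : Param d → Param d} (hU : ContDiff ℝ 2 U) (R : ℝ) :
    ∃ B, LocalBounds U R B := by
  have hJ : ContDiff ℝ 1 (fderiv ℝ U) := hU.fderiv_right (by norm_num)
  have hd : Differentiable ℝ U := hU.differentiable (by norm_num)
  obtain ⟨C₀, h₀⟩ := exists_bound_on_ball hU.continuous R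
  obtain ⟨C₁, h₁⟩ := exists_bound_on_ball hJ.continuous R
  obtain ⟨C₂, h₂⟩ := exists_bound_on_ball (hJ.continuous_fderiv (by norm_num)) R
  set B := max (max C₀ C₁) (max C₂ 1) with hB
  have b₀ : C₀ ≤ B := by simp [hB]
  have b₁ : C₁ ≤ B := by simp [hB]
  have b₂ : C₂ ≤ B := by simp [hB]
  have b₃ : 1 ≤ B := by simp [hB]
  have hlip : ∀ x y, ‖x‖ ≤ R → ‖y‖ ≤ R →
      ‖fderiv ℝ U y - fderiv ℝ U x‖ ≤ B * ‖y - x‖ := by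
    intro x y hx hy
    refine (convex_closedBall (0 : Param d) R).norm_image_sub_le_of_norm_fderiv_le (𝕜 := ℝ)
      (fun z _ => hJ.differentiable (by norm_num) z)
      (fun z hz => (h₂ z (by simpa using hz)).trans b₂) (by simpa using hx) (by simpa using hy)
  refine ⟨B, b₃, fun x hx => (h₀ x hx).trans b₀, fun x hx => (h₁ x hx).trans b₁, hlip, ?_, ?_⟩
  · intro x y hx hy
    refine (convex_closedBall (0 : Param d) R).norm_image_sub_le_of_norm_fderiv_le (𝕜 := ℝ)
      (fun z _ => hd z)
      (fun z hz => (h₁ z (by simpa using hz)).trans b₁) (by simpa using hx) (by simpa using hy)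
  · intro x y hx hy
    have hseg : segment ℝ x y ⊆ Metric.closedBall (0 : Param d) R :=
      (convex_closedBall (0 : Param d) R).segment_subset (by simpa using hx) (by simpa using hy)
    -- Along the segment the derivative stays within B‖y - x‖ of `fderiv ℝ U x`, so the mean value
    -- inequality for U minus its linear part gives the quadratic remainder.
    have := (convex_segment x y).norm_image_sub_le_of_norm_fderiv_le' (𝕜 := ℝ) (f := U)
      (φ := fderiv ℝ U x) (C := B * ‖y - x‖) (fun z _ => hd z) (fun z hz => ?_)
      (left_mem_segment ℝ x y) (right_mem_segment ℝ x y)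
    · linarith [this, (by ring : B * ‖y - x‖ * ‖y - x‖ = B * ‖y - x‖ ^ 2)]
    · refine (hlip x z hx (by simpa using hseg hz)).trans ?_
      have : ‖z - x‖ ≤ ‖y - x‖ := norm_sub_le_of_mem_segment hz
      gcongr

lemma LocalBounds.mono {U : Param d → Param d} {R B B' : ℝ} (h : LocalBounds U R B)
    (hB : B ≤ B') : LocalBounds U R B' where
  one_le := h.one_le.trans hB
  norm_le x hx := (h.norm_le x hx).trans hB
  fderiv_le x hx := (h.fderiv_le x hx).trans hB
  fderiv_lip x y hx hy := (h.fderiv_lip x y hx hy).trans (by gcongr)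
  lip x y hx hy := (h.lip x y hx hy).trans (by gcongr)
  taylor x y hx hy := (h.taylor x y hx hy).trans (by gcongr)

lemma exists_radius {K : Set (Param d)} (hK : IsCompact K) :
    ∃ R : ℝ, 0 < R ∧ ∀ x ∈ K, ‖x‖ ≤ R := by
  obtain ⟨R, h0, hR⟩ := hK.isBounded.subset_closedBall_lt 0 0
  exact ⟨R, h0, fun x hx => by simpa using hR hx⟩

lemma LocO.on_ball {F : Type*} [Norm F] {m : ℕ} {r : ℝ → Param d → F} (h : LocO m r) (R : ℝ) :
    ∃ C η₀ : ℝ, 0 < η₀ ∧ ∀ η : ℝ, 0 < η → η < η₀ → ∀ θ, ‖θ‖ ≤ R → ‖r η θ‖ ≤ C * η ^ m := by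
  obtain ⟨C, η₀, h0, h⟩ := h _ (isCompact_closedBall (0 : Param d) R)
  exact ⟨C, η₀, h0, fun η h1 h2 θ hθ => h η h1 h2 θ (by simpa using hθ)⟩

lemma locO_of_ball {F : Type*} [Norm F] {m : ℕ} {r : ℝ → Param d → F}
    (h : ∀ R : ℝ, 0 < R → ∃ C η₀ : ℝ, 0 < η₀ ∧
      ∀ η : ℝ, 0 < η → η < η₀ → ∀ θ, ‖θ‖ ≤ R → ‖r η θ‖ ≤ C * η ^ m) : LocO m r := by
  intro K hK
  obtain ⟨R, h0, hR⟩ := exists_radius hK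
  obtain ⟨C, η₀, h1, h⟩ := h R h0
  exact ⟨C, η₀, h1, fun η h2 h3 θ hθ => h η h2 h3 θ (hR θ hθ)⟩

lemma LocO.add {F : Type*} [SeminormedAddCommGroup F] {m : ℕ} {r s : ℝ → Param d → F}
    (hr : LocO m r) (hs : LocO m s) : LocO m fun η θ => r η θ + s η θ := by
  intro K hK
  obtain ⟨C, η₀, h0, h⟩ := hr K hK
  obtain ⟨C', η₁, h1, h'⟩ := hs K hK
  refine ⟨C + C', min η₀ η₁, lt_min h0 h1, fun η h2 h3 θ hθ => ?_⟩
  have a := h η h2 (h3.trans_le (min_le_left _ _)) θ hθ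
  have b := h' η h2 (h3.trans_le (min_le_right _ _)) θ hθ
  linarith [norm_add_le (r η θ) (s η θ), add_mul C C' (η ^ m)]

lemma LocO.neg {F : Type*} [SeminormedAddCommGroup F] {m : ℕ} {r : ℝ → Param d → F}
    (hr : LocO m r) : LocO m fun η θ => -r η θ := by
  intro K hK
  obtain ⟨C, η₀, h0, h⟩ := hr K hK
  exact ⟨C, η₀, h0, fun η h2 h3 θ hθ => by simpa using h η h2 h3 θ hθ⟩

lemma LocO.congr {F : Type*} [Norm F] {m : ℕ} {r s : ℝ → Param d → F}
    (hr : LocO m r) (hrs : ∀ η, 0 < η → ∀ θ, r η θ = s η θ) : LocO m s := by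
  intro K hK
  obtain ⟨C, η₀, h0, h⟩ := hr K hK
  exact ⟨C, η₀, h0, fun η h2 h3 θ hθ => hrs η h2 θ ▸ h η h2 h3 θ hθ⟩

/-- Cancelling one power of `η`. -/
lemma LocO.of_smul {F : Type*} [SeminormedAddCommGroup F] [NormedSpace ℝ F] {m : ℕ}
    {r : ℝ → Param d → F} (hr : LocO (m + 1) fun η θ => η • r η θ) : LocO m r := by
  intro K hK
  obtain ⟨C, η₀, h0, h⟩ := hr K hK
  refine ⟨C, η₀, h0, fun η h2 h3 θ hθ => ?_⟩
  have a := h η h2 h3 θ hθ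
  rw [norm_smul, Real.norm_eq_abs, abs_of_pos h2, pow_succ] at a
  refine le_of_mul_le_mul_left (a.trans_eq ?_) h2
  ring

lemma LocO.const_smul {F : Type*} [SeminormedAddCommGroup F] [NormedSpace ℝ F] {m : ℕ}
    {r : ℝ → Param d → F} (hr : LocO m r) (a : ℝ) : LocO m fun η θ => a • r η θ := by
  intro K hK
  obtain ⟨C, η₀, h0, h⟩ := hr K hK
  refine ⟨|a| * C, η₀, h0, fun η h2 h3 θ hθ => ?_⟩
  rw [norm_smul, Real.norm_eq_abs, mul_assoc]
  exact mul_le_mul_of_nonneg_left (h η h2 h3 θ hθ) (abs_nonneg _)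

/-! ### The leading potential and its gradient. -/

lemma contDiff_selfForce {U : Param d → Param d} (hU : ContDiff ℝ 2 U) :
    ContDiff ℝ 1 (selfForce U) :=
  (hU.fderiv_right (m := 1) (by norm_num)).clm_apply (hU.of_le (by norm_num))

lemma contDiff_leading {U : Param d → Param d} (hU : ContDiff ℝ 2 U) (η : ℝ) :
    ContDiff ℝ 2 (leading U η) :=
  contDiff_const.mul (hU.norm_sq ℝ)

/-- The derivative of ‖U‖² along v is 2⟨U, J_U v⟩, and symmetry moves J_U to the other factor. -/
lemma hasGradientAt_leading {U : Param d → Param d} (hU : ContDiff ℝ 2 U)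
    (hsym : SymmetricJacobian U) (η : ℝ) (θ : Param d) :
    HasGradientAt (leading U η) ((η / 2) • selfForce U θ) θ := by
  have h := ((hU.differentiable (by norm_num) θ).hasFDerivAt.norm_sq).const_mul (η / 4)
  rw [hasGradientAt_iff_hasFDerivAt]
  refine h.congr_fderiv ?_
  ext v
  have : inner ℝ (fderiv ℝ U θ (U θ)) v = inner ℝ (U θ) (fderiv ℝ U θ v) := hsym θ (U θ) v
  simp [selfForce, this]
  ring

lemma gradient_leading {U : Param d → Param d} (hU : ContDiff ℝ 2 U)
    (hsym : SymmetricJacobian U) (η : ℝ) :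
    gradient (leading U η) = fun θ => (η / 2) • selfForce U θ :=
  funext fun θ => (hasGradientAt_leading hU hsym η θ).gradient

/-- A potential whose gradient is known to order `η²` is known to order `η²` up to a constant. -/
lemma eqLeadingUpToConst_of_gradient {U : Param d → Param d} (hU : ContDiff ℝ 2 U)
    (hsym : SymmetricJacobian U) {φ : ℝ → Param d → ℝ}
    (hφ : ∀ η : ℝ, 0 < η → Differentiable ℝ (φ η))
    (h : LocO 2 fun η θ => gradient (φ η) θ - (η / 2) • selfForce U θ) :
    EqLeadingUpToConst U φ := by
  -- The constant makes both functions agree at the origin, so it serves every ball. The mean value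
  -- inequality from 0 then costs a factor R.
  refine ⟨fun η => -(φ η 0 - leading U η 0), locO_of_ball fun R hR => ?_⟩
  obtain ⟨C, η₀, h0, h⟩ := h.on_ball R
  refine ⟨C * R, η₀, h0, fun η h1 h2 θ hθ => ?_⟩
  have hC : 0 ≤ C * η ^ 2 := (norm_nonneg _).trans (h η h1 h2 θ hθ)
  have hg : ∀ x, HasFDerivAt (fun y => φ η y - leading U η y)
      ((InnerProductSpace.toDual ℝ (Param d)) (gradient (φ η) x - (η / 2) • selfForce U x)) x := by
    intro x
    rw [map_sub]
    exact (hφ η h1 x).hasGradientAt.hasFDerivAt.sub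
      (hasGradientAt_leading hU hsym η x).hasFDerivAt
  have key := (convex_closedBall (0 : Param d) R).norm_image_sub_le_of_norm_hasFDerivWithin_le
    (fun x _ => (hg x).hasFDerivWithinAt) (C := C * η ^ 2) (x := 0) (y := θ)
    (fun x hx => by
      rw [LinearIsometryEquiv.norm_map]; exact h η h1 h2 x (by simpa using hx))
    (by simpa using hR.le) (by simpa using hθ)
  have e : φ η θ + -(φ η 0 - leading U η 0) - leading U η θ
      = φ η θ - leading U η θ - (φ η 0 - leading U η 0) := by ring
  rw [e]
  refine key.trans ?_
  rw [sub_zero]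
  calc C * η ^ 2 * ‖θ‖ ≤ C * η ^ 2 * R := by gcongr
    _ = C * R * η ^ 2 := by ring

/-! ### Time reversal asymmetry -/

lemma recovered_expansion {U : Param d → Param d} (hU : ContDiff ℝ 2 U) :
    LocO 3 fun η θ => η ^ 2 • selfForce U θ - (θ - recovered U η θ) := by
  refine locO_of_ball fun R hR => ?_
  obtain ⟨B, hB⟩ := exists_localBounds hU (R + 1)
  have hB0 : 0 < B := one_pos.trans_le hB.one_le
  -- For ηB ≤ 1 the Euler step moves θ by at most 1 and stays in the ball where B is valid.
  refine ⟨B ^ 3, B⁻¹, by positivity, fun η h1 h2 θ hθ => ?_⟩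
  have hηB : η * B ≤ 1 := by
    have := mul_lt_mul_of_pos_right h2 hB0
    rw [inv_mul_cancel₀ hB0.ne'] at this; exact this.le
  have hUθ := hB.norm_le θ (by linarith)
  have hs : ‖η • U θ‖ ≤ η * B := by
    rw [norm_smul, Real.norm_eq_abs, abs_of_pos h1]; gcongr
  have hy : ‖θ - η • U θ‖ ≤ R + 1 := (norm_sub_le _ _).trans (by linarith)
  have ht := hB.taylor θ (θ - η • U θ) (by linarith) hy
  have e1 : θ - η • U θ - θ = -(η • U θ) := by abel
  rw [e1, norm_neg, map_neg, map_smul] at ht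
  have e : η ^ 2 • selfForce U θ - (θ - recovered U η θ)
      = η • (U (θ - η • U θ) - U θ - -(η • fderiv ℝ U θ (U θ))) := by
    simp only [recovered, update, selfForce]
    module
  rw [e, norm_smul, Real.norm_eq_abs, abs_of_pos h1]
  calc η * _ ≤ η * (B * (η * B) ^ 2) := by
        refine mul_le_mul_of_nonneg_left (ht.trans ?_) h1.le
        gcongr
    _ = B ^ 3 * η ^ 3 := by ring

lemma isTAPotential_leading {U : Param d → Param d} (hU : ContDiff ℝ 2 U)
    (hsym : SymmetricJacobian U) : IsTAPotential U (leading U) where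
  smooth η _ := (contDiff_leading hU η).differentiable (by norm_num)
  force := (recovered_expansion hU).congr fun η _ θ => by
    rw [gradient_leading hU hsym, smul_smul]
    congr 2
    ring

lemma IsTAPotential.eqLeading {U : Param d → Param d} (hU : ContDiff ℝ 2 U)
    (hsym : SymmetricJacobian U) {φ : ℝ → Param d → ℝ} (h : IsTAPotential U φ) :
    EqLeadingUpToConst U φ := by
  refine eqLeadingUpToConst_of_gradient hU hsym h.smooth (LocO.of_smul ?_)
  refine ((h.force.add (recovered_expansion hU).neg).const_smul (1 / 2)).congr fun η _ θ => ?_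
  module

lemma continuous_recovered {U : Param d → Param d} (hU : Continuous U) (η : ℝ) :
    Continuous (recovered U η) := by
  unfold recovered update
  fun_prop

/-- The force (η/2)G is an exact gradient, so its integral along the segment is a difference of
endpoint values. The exact force differs from it by O(η²), uniformly on the segment, although it
need not be a gradient itself. -/
lemma taLinePotential_eqLeading {U : Param d → Param d} (hU : ContDiff ℝ 2 U)
    (hsym : SymmetricJacobian U) (θref : Param d) :
    EqLeading U fun η θ => taLinePotential U θref η θ + leading U η θref := by
  refine locO_of_ball fun R hR => ?_
  obtain ⟨C, η₀, h0, h⟩ := (recovered_expansion hU).on_ball (R + ‖θref‖)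
  refine ⟨C / 2 * (R + ‖θref‖), η₀, h0, fun η h1 h2 θ hθ => ?_⟩
  set v := θ - θref with hv
  set p : ℝ → Param d := fun s => θref + s • v with hp
  have hpc : Continuous p := by fun_prop
  have hvn : ‖v‖ ≤ R + ‖θref‖ := (norm_sub_le _ _).trans (by linarith)
  have hder : ∀ s, HasDerivAt (fun s => leading U η (p s))
      (inner ℝ ((η / 2) • selfForce U (p s)) v) s := by
    intro s
    have h1 : HasDerivAt p v s := by
      simpa [hp] using ((hasDerivAt_id s).smul_const v).const_add θref
    have := (hasGradientAt_leading hU hsym η (p s)).hasFDerivAt.comp_hasDerivAt s h1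
    simpa [real_inner_smul_left, Function.comp_def] using this
  have hc1 : Continuous fun s => inner ℝ ((η / 2) • selfForce U (p s)) v := by
    have := (contDiff_selfForce hU).continuous
    fun_prop
  have hc2 : Continuous fun s => inner ℝ ((2 * η)⁻¹ • (p s - recovered U η (p s))) v := by
    have := continuous_recovered hU.continuous η
    fun_prop
  have hint := intervalIntegral.integral_eq_sub_of_hasDerivAt (fun s _ => hder s)
    (hc1.intervalIntegrable 0 1)
  have hp1 : p 1 = θ := by simp [hp, hv]
  have hp0 : p 0 = θref := by simp [hp]
  rw [hp1, hp0] at hint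
  have e : taLinePotential U θref η θ + leading U η θref - leading U η θ
      = ∫ s in (0 : ℝ)..1, (inner ℝ ((2 * η)⁻¹ • (p s - recovered U η (p s))) v
        - inner ℝ ((η / 2) • selfForce U (p s)) v) := by
    rw [intervalIntegral.integral_sub (hc2.intervalIntegrable 0 1)
      (hc1.intervalIntegrable 0 1), hint]
    simp only [taLinePotential, ← hv, hp]
    ring
  rw [e]
  refine (intervalIntegral.norm_integral_le_of_norm_le_const (C := C / 2 * (R + ‖θref‖) * η ^ 2)
    fun s hs => ?_).trans_eq (by norm_num)
  rw [Set.uIoc_of_le zero_le_one] at hs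
  have hps : ‖p s‖ ≤ R + ‖θref‖ := by
    have : p s = (1 - s) • θref + s • θ := by simp only [hp, hv]; module
    rw [this]
    refine (norm_add_le _ _).trans ?_
    rw [norm_smul, norm_smul, Real.norm_eq_abs, Real.norm_eq_abs,
      abs_of_nonneg (by linarith [hs.2]), abs_of_pos hs.1]
    nlinarith [norm_nonneg θref, norm_nonneg θ, hs.1, hs.2]
  have hb := h η h1 h2 (p s) hps
  rw [← inner_sub_left]
  have e2 : (2 * η)⁻¹ • (p s - recovered U η (p s)) - (η / 2) • selfForce U (p s)
      = (-(2 * η)⁻¹) • (η ^ 2 • selfForce U (p s) - (p s - recovered U η (p s))) := by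
    rw [smul_sub (-(2 * η)⁻¹), smul_smul]
    have : -(2 * η)⁻¹ * η ^ 2 = -(η / 2) := by field_simp
    rw [this]
    module
  rw [e2]
  refine (norm_inner_le_norm _ _).trans ?_
  rw [norm_smul, norm_neg, norm_inv, Real.norm_eq_abs, abs_of_pos (by positivity : 0 < 2 * η)]
  have hC : 0 ≤ C * η ^ 3 := (norm_nonneg _).trans hb
  calc _ ≤ (2 * η)⁻¹ * (C * η ^ 3) * (R + ‖θref‖) := by gcongr
    _ = C / 2 * (R + ‖θref‖) * η ^ 2 := by field_simp


/-! ### Discretization error -/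

lemma IsFlowLine.continuousOn {V : Param d → Param d} {η T : ℝ} {θ : Param d} {γ : ℝ → Param d}
    (h : IsFlowLine V η T θ γ) : ContinuousOn γ (Set.Icc 0 T) :=
  fun s hs => (h.2 s hs).continuousWithinAt

/-- A flow line stays near its starting point for a time inversely proportional to `η`. -/
lemma IsFlowLine.norm_sub_le {V : Param d → Param d} {η T M R : ℝ} {θ : Param d}
    {γ : ℝ → Param d} (h : IsFlowLine V η T θ γ) (hη : 0 < η)
    (hM : ∀ x, ‖x‖ ≤ R + 1 → ‖V x‖ < M) (hθ : ‖θ‖ ≤ R) (hT : η * M * T ≤ 1) :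
    ∀ s ∈ Set.Icc (0 : ℝ) T, ‖γ s - θ‖ ≤ η * M * s := by
  have hM0 : 0 < M := (norm_nonneg _).trans_lt (hM θ (by linarith))
  intro s hs
  -- Barrier argument: the speed has to be bounded only at times where ‖γ s - θ‖ equals ηMs, and
  -- there γ s is still in the ball. This is why the bound on V is strict.
  refine image_norm_le_of_norm_deriv_right_lt_deriv_boundary (f := fun s => γ s - θ)
    (f' := fun s => -(η • V (γ s))) (a := 0) (b := T) (B := fun s => η * M * s)
    (B' := fun _ => η * M) (h.continuousOn.sub continuousOn_const) ?_ (by simp [h.1]) ?_ ?_ hs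
  · intro x hx
    exact ((h.2 x ⟨hx.1, hx.2.le⟩).sub_const θ).mono_of_mem_nhdsWithin
      (mem_of_superset (Icc_mem_nhdsGE hx.2) (Set.Icc_subset_Icc_left hx.1))
  · intro x
    simpa using (hasDerivAt_id x).const_mul (η * M)
  · intro x hx hxe
    have h1 : η * M * x ≤ η * M * T := by gcongr; exact hx.2.le
    have h2 : ‖γ x‖ ≤ R + 1 := by
      have := norm_add_le (γ x - θ) θ
      rw [sub_add_cancel] at this
      linarith
    rw [norm_neg, norm_smul, Real.norm_eq_abs, abs_of_pos hη]
    exact mul_lt_mul_of_pos_left (hM _ h2) hη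

lemma IsFlowLine.shift {V : Param d → Param d} {η T t S : ℝ} {θ : Param d} {γ : ℝ → Param d}
    (h : IsFlowLine V η T θ γ) (ht : 0 ≤ t) (hS : t + S ≤ T) :
    IsFlowLine V η S (γ t) fun s => γ (t + s) := by
  refine ⟨by simp, fun s hs => ?_⟩
  have hmaps : Set.MapsTo (fun s => t + s) (Set.Icc 0 S) (Set.Icc 0 T) :=
    fun x hx => ⟨add_nonneg ht hx.1, by linarith [hx.2]⟩
  have h1 := (h.2 (t + s) (hmaps hs)).scomp s
    ((hasDerivAt_id s).const_add t).hasDerivWithinAt hmaps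
  simpa [Function.comp_def] using h1

/-- Expansion of the time-one flow of a field `U + P` with `P = O(η)`. -/
lemma IsFlowLine.expansion {U P : Param d → Param d} {η B R : ℝ} {θ : Param d} {γ : ℝ → Param d}
    (hd : Differentiable ℝ P) (hB : LocalBounds U (R + 1) B)
    (hP : ∀ x, ‖x‖ ≤ R + 1 → ‖P x‖ ≤ B * η)
    (hDP : ∀ x, ‖x‖ ≤ R + 1 → ‖fderiv ℝ P x‖ ≤ B * η) (hη : 0 < η)
    (hηB : 3 * B * η ≤ 1) (hθ : ‖θ‖ ≤ R) (h : IsFlowLine (fun x => U x + P x) η 1 θ γ) :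
    ‖γ 1 - (θ - η • U θ - η • P θ + (η ^ 2 / 2) • selfForce U θ)‖ ≤ 16 * B ^ 3 * η ^ 3 := by
  have hB1 := hB.one_le
  have hB0 : 0 < B := by linarith
  have hη1 : η ≤ 1 := by nlinarith
  have hθ' : ‖θ‖ ≤ R + 1 := by linarith
  have hV : ∀ x, ‖x‖ ≤ R + 1 → ‖U x + P x‖ < 3 * B := fun x hx => by
    have := norm_add_le (U x) (P x)
    nlinarith [hB.norm_le x hx, hP x hx]
  have hnear : ∀ s ∈ Set.Icc (0 : ℝ) 1, ‖γ s - θ‖ ≤ 3 * B * η := fun s hs => by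
    have := h.norm_sub_le hη hV hθ (by linarith) s hs
    nlinarith [hs.2, mul_pos hη hB0]
  have hball : ∀ s ∈ Set.Icc (0 : ℝ) 1, ‖γ s‖ ≤ R + 1 := fun s hs => by
    have := norm_add_le (γ s - θ) θ
    rw [sub_add_cancel] at this
    linarith [hnear s hs]
  -- The first-order expansion, to be fed into the linear term of the second-order one. The 4 is 3B²
  -- from the variation of U plus B ≤ B² from P.
  have hfirst : ∀ s ∈ Set.Icc (0 : ℝ) 1, ‖γ s - θ + (s * η) • U θ‖ ≤ 4 * B ^ 2 * η ^ 2 := by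
    intro s hs
    have hder : ∀ x ∈ Set.Icc (0 : ℝ) 1, HasDerivWithinAt (fun x => γ x - θ + (x * η) • U θ)
        (-(η • (U (γ x) + P (γ x))) + η • U θ) (Set.Icc 0 1) x := fun x hx => by
      have h1 : HasDerivWithinAt (fun x : ℝ => (x * η) • U θ) (η • U θ) (Set.Icc 0 1) x := by
        simpa using (((hasDerivAt_id x).mul_const η).smul_const (U θ)).hasDerivWithinAt
      exact ((h.2 x hx).sub_const θ).add h1
    have := norm_image_sub_le_of_norm_deriv_le_segment' hder (C := 4 * B ^ 2 * η ^ 2)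
      (fun x hx => ?_) s hs
    · simp only [h.1, sub_self, zero_mul, zero_smul, add_zero, sub_zero] at this
      nlinarith [hs.1, hs.2, sq_nonneg (B * η)]
    · have hx' : x ∈ Set.Icc (0 : ℝ) 1 := ⟨hx.1, hx.2.le⟩
      have e : -(η • (U (γ x) + P (γ x))) + η • U θ = -(η • ((U (γ x) - U θ) + P (γ x))) := by
        module
      rw [e, norm_neg, norm_smul, Real.norm_eq_abs, abs_of_pos hη]
      have l1 : ‖U (γ x) - U θ‖ ≤ B * (3 * B * η) :=
        (hB.lip θ (γ x) hθ' (hball x hx')).trans (by gcongr; exact hnear x hx')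
      have l2 := hP (γ x) (hball x hx')
      have l3 := norm_add_le (U (γ x) - U θ) (P (γ x))
      have l4 : B * η ≤ B ^ 2 * η := by gcongr; nlinarith
      calc η * _ ≤ η * (4 * B ^ 2 * η) := by gcongr; linarith
        _ = _ := by ring
  have hder : ∀ x ∈ Set.Icc (0 : ℝ) 1,
      HasDerivWithinAt (fun x => γ x - (θ - (x * η) • (U θ + P θ)
          + (x ^ 2 * (η ^ 2 / 2)) • selfForce U θ))
        (-(η • (U (γ x) + P (γ x)))
          - (-(η • (U θ + P θ)) + (x * η ^ 2) • selfForce U θ)) (Set.Icc 0 1) x := fun x hx => by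
    have h1 : HasDerivWithinAt (fun x : ℝ => (x * η) • (U θ + P θ)) (η • (U θ + P θ))
        (Set.Icc 0 1) x := by
      simpa using (((hasDerivAt_id x).mul_const η).smul_const (U θ + P θ)).hasDerivWithinAt
    have h2 : HasDerivWithinAt (fun x : ℝ => (x ^ 2 * (η ^ 2 / 2)) • selfForce U θ)
        ((x * η ^ 2) • selfForce U θ) (Set.Icc 0 1) x := by
      have := ((((hasDerivAt_id x).pow 2).mul_const (η ^ 2 / 2)).smul_const
        (selfForce U θ)).hasDerivWithinAt (s := Set.Icc 0 1)
      refine (this.congr_deriv ?_)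
      congr 1
      simp
      ring
    exact (h.2 x hx).sub ((h1.const_sub θ).add h2)
  have := norm_image_sub_le_of_norm_deriv_le_segment' hder (C := 16 * B ^ 3 * η ^ 3)
    (fun x hx => ?_) 1 ⟨zero_le_one, le_rfl⟩
  · have e : θ - η • U θ - η • P θ + (η ^ 2 / 2) • selfForce U θ
        = θ - ((1 : ℝ) * η) • (U θ + P θ) + ((1 : ℝ) ^ 2 * (η ^ 2 / 2)) • selfForce U θ := by
      module
    rw [e]
    simpa [h.1] using this
  · have hx' : x ∈ Set.Icc (0 : ℝ) 1 := ⟨hx.1, hx.2.le⟩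
    have hγ := hball x hx'
    -- Three errors: the Taylor remainder of U, the first-order error pushed through J_U, and the
    -- variation of P. They contribute 9 + 4 + 3 = 16 times B³η².
    have e : -(η • (U (γ x) + P (γ x))) - (-(η • (U θ + P θ)) + (x * η ^ 2) • selfForce U θ)
        = -(η • ((U (γ x) - U θ - fderiv ℝ U θ (γ x - θ))
          + fderiv ℝ U θ (γ x - θ + (x * η) • U θ) + (P (γ x) - P θ))) := by
      simp only [selfForce, map_add, map_smul]
      module
    rw [e, norm_neg, norm_smul, Real.norm_eq_abs, abs_of_pos hη]
    have l1 : ‖U (γ x) - U θ - fderiv ℝ U θ (γ x - θ)‖ ≤ B * (3 * B * η) ^ 2 :=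
      (hB.taylor θ (γ x) hθ' hγ).trans (by gcongr; exact hnear x hx')
    have l2 : ‖fderiv ℝ U θ (γ x - θ + (x * η) • U θ)‖ ≤ B * (4 * B ^ 2 * η ^ 2) :=
      (fderiv ℝ U θ).le_of_opNorm_le_of_le (hB.fderiv_le θ hθ') (hfirst x hx')
    have l3 : ‖P (γ x) - P θ‖ ≤ B * η * (3 * B * η) :=
      ((convex_closedBall (0 : Param d) (R + 1)).norm_image_sub_le_of_norm_fderiv_le (𝕜 := ℝ)
        (fun z _ => hd z) (fun z hz => hDP z (by simpa using hz)) (by simpa using hθ')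
        (by simpa using hγ)).trans (by gcongr; exact hnear x hx')
    have l4 : 3 * B ^ 2 * η ^ 2 ≤ 3 * B ^ 3 * η ^ 2 := by
      gcongr
      norm_num
    calc η * _ ≤ η * (16 * B ^ 3 * η ^ 2) := by
          gcongr
          refine (norm_add₃_le).trans ?_
          nlinarith [l1, l2, l3, l4]
      _ = _ := by ring

/-- Common local bounds for a field and an `O(η)` correction. -/
lemma exists_correction_bounds {U : Param d → Param d} (hU : ContDiff ℝ 2 U)
    {P : ℝ → Param d → Param d} (hP : LocO 1 P) (hDP : LocO 1 fun η θ => fderiv ℝ (P η) θ)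
    (R : ℝ) : ∃ B η₀ : ℝ, 0 < η₀ ∧ η₀ ≤ 1 ∧ 3 * B * η₀ ≤ 1 ∧ LocalBounds U R B ∧
      ∀ η : ℝ, 0 < η → η < η₀ → ∀ x, ‖x‖ ≤ R →
        ‖P η x‖ ≤ B * η ∧ ‖fderiv ℝ (P η) x‖ ≤ B * η := by
  obtain ⟨B, hB⟩ := exists_localBounds hU R
  obtain ⟨C₁, η₁, h₁, hC₁⟩ := hP.on_ball R
  obtain ⟨C₂, η₂, h₂, hC₂⟩ := hDP.on_ball R
  set B' := max B (max C₁ C₂)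
  have hB'0 : 0 < B' := one_pos.trans_le (hB.one_le.trans (le_max_left _ _))
  have hB'1 : 1 ≤ B' := hB.one_le.trans (le_max_left _ _)
  have m1 : C₁ ≤ B' := (le_max_left _ _).trans (le_max_right _ _)
  have m2 : C₂ ≤ B' := (le_max_right _ _).trans (le_max_right _ _)
  refine ⟨B', min (min η₁ η₂) (1 / (3 * B')), ?_, ?_, ?_, hB.mono (le_max_left _ _), ?_⟩
  · exact lt_min (lt_min h₁ h₂) (by positivity)
  · refine (min_le_right _ _).trans ?_
    rw [div_le_one (by positivity)]
    linarith
  · calc 3 * B' * _ ≤ 3 * B' * (1 / (3 * B')) := by gcongr; exact min_le_right _ _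
      _ = 1 := by field_simp
  · intro η h h' x hx
    have a := hC₁ η h (h'.trans_le ((min_le_left _ _).trans (min_le_left _ _))) x hx
    have b := hC₂ η h (h'.trans_le ((min_le_left _ _).trans (min_le_right _ _))) x hx
    rw [pow_one] at a b
    exact ⟨a.trans (by gcongr), b.trans (by gcongr)⟩

lemma differentiable_gradient {φ : Param d → ℝ} (hφ : ContDiff ℝ 2 φ) :
    Differentiable ℝ (gradient φ) := by
  have h : Differentiable ℝ (fderiv ℝ φ) :=
    (hφ.fderiv_right (m := 1) (by norm_num)).differentiable (by norm_num)
  exact ((InnerProductSpace.toDual ℝ (Param d)).symm.toContinuousLinearEquiv.differentiable).comp h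

lemma IsDEPotential.eqLeading {U : Param d → Param d} (hU : ContDiff ℝ 2 U)
    (hsym : SymmetricJacobian U) {φ : ℝ → Param d → ℝ} (h : IsDEPotential U φ) :
    EqLeadingUpToConst U φ := by
  refine eqLeadingUpToConst_of_gradient hU hsym
    (fun η hη => (h.smooth η hη).differentiable (by norm_num)) (LocO.of_smul ?_)
  refine locO_of_ball fun R _ => ?_
  obtain ⟨B, η₁, h1, h1', hB1, hB, hP⟩ :=
    exists_correction_bounds hU h.force_small h.deriv_small (R + 1)
  -- A single step already determines the gradient: the gap between flow and update is η(∇φ_η -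
  -- (η/2)G) up to O(η³).
  obtain ⟨C, η₂, h2, hm⟩ := h.matching 1 _ (isCompact_closedBall (0 : Param d) R)
  refine ⟨C + 16 * B ^ 3, min η₁ η₂, lt_min h1 h2, fun η h3 h4 θ hθ => ?_⟩
  have h5 := h4.trans_le (min_le_left _ _)
  obtain ⟨γ, hγ, ht⟩ := hm η h3 (h4.trans_le (min_le_right _ _)) θ (by simpa using hθ)
  have hstep := ht 1 le_rfl
  rw [Nat.cast_one] at hγ hstep
  have hB0 := hB.one_le
  have hexp := hγ.expansion (differentiable_gradient (h.smooth η h3)) hB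
    (fun x hx => (hP η h3 h5 x hx).1) (fun x hx => (hP η h3 h5 x hx).2) h3
    (by nlinarith) hθ
  have e : η • (gradient (φ η) θ - (η / 2) • selfForce U θ)
      = ((update U η)^[1] θ - γ 1) +
        (γ 1 - (θ - η • U θ - η • gradient (φ η) θ + (η ^ 2 / 2) • selfForce U θ)) := by
    simp only [Function.iterate_one, update]
    module
  rw [e]
  refine (norm_add_le _ _).trans ?_
  linarith [add_mul C (16 * B ^ 3) (η ^ 3)]

/-- The corrected field need not be globally Lipschitz, so Picard–Lindelöf is applied on the unit
ball around θ. The condition ηMT ≤ 1 keeps the curve inside it, and the whole interval is covered at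
once. -/
lemma exists_isFlowLine {V : Param d → Param d} (hV : ContDiff ℝ 1 V) {η M R T : ℝ}
    (hη : 0 < η) (hT : 0 ≤ T) (hM : ∀ x, ‖x‖ ≤ R + 1 → ‖V x‖ ≤ M) (hηM : η * M * T ≤ 1)
    {θ : Param d} (hθ : ‖θ‖ ≤ R) : ∃ γ, IsFlowLine V η T θ γ := by
  have hM0 : 0 ≤ M := (norm_nonneg _).trans (hM θ (by linarith))
  have hc : ContDiff ℝ 1 fun x => -(η • V x) := (hV.const_smul η).neg
  have hsub : ∀ x ∈ Metric.closedBall θ 1, ‖x‖ ≤ R + 1 := fun x hx => by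
    have := norm_add_le (x - θ) θ
    rw [sub_add_cancel] at this
    rw [Metric.mem_closedBall, dist_eq_norm] at hx
    linarith
  obtain ⟨L, hL⟩ := exists_bound_on_ball (hc.continuous_fderiv (by norm_num)) (R + 1)
  have hlip : LipschitzOnWith L.toNNReal (fun x => -(η • V x)) (Metric.closedBall θ 1) := by
    refine LipschitzOnWith.of_dist_le_mul fun x hx y hy => ?_
    rw [dist_eq_norm, dist_eq_norm]
    exact (convex_closedBall θ 1).norm_image_sub_le_of_norm_fderiv_le (𝕜 := ℝ)
      (fun z _ => hc.differentiable (by norm_num) z)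
      (fun z hz => (hL z (hsub z hz)).trans (Real.le_coe_toNNReal L)) hy hx
  have hpl : IsPicardLindelof (fun _ x => -(η • V x)) (tmin := 0) (tmax := T)
      ⟨0, le_rfl, hT⟩ θ 1 0 (⟨η * M, by positivity⟩ : NNReal) L.toNNReal :=
    { lipschitzOnWith := fun t _ => by simpa using hlip
      continuousOn := fun x _ => continuousOn_const
      norm_le := fun t _ x hx => by
        rw [norm_neg, norm_smul, Real.norm_eq_abs, abs_of_pos hη]
        exact mul_le_mul_of_nonneg_left (hM x (hsub x (by simpa using hx))) hη.le
      mul_max_le := by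
        change η * M * max (T - 0) (0 - 0) ≤ 1 - 0
        simpa [hT] using hηM }
  obtain ⟨γ, h0, hγ⟩ := hpl.exists_eq_forall_mem_Icc_hasDerivWithinAt₀
  exact ⟨γ, h0, hγ⟩

lemma locO_smul_of_continuous {F : Type*} [NormedAddCommGroup F] [NormedSpace ℝ F]
    {f : Param d → F} (hf : Continuous f) : LocO 1 fun η θ => (η / 2) • f θ := by
  refine locO_of_ball fun R _ => ?_
  obtain ⟨C, hC⟩ := exists_bound_on_ball hf R
  refine ⟨C / 2, 1, one_pos, fun η h1 _ θ hθ => ?_⟩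
  rw [norm_smul, Real.norm_eq_abs, abs_of_pos (by positivity)]
  nlinarith [hC θ hθ]

/-- Each step makes an O(η³) error relative to the flow line, and `update U η` amplifies earlier
errors by at most 1 + Λ, because η ≤ 1. Over a fixed number of steps the total remains O(η³). -/
lemma isDEPotential_leading {U : Param d → Param d} (hU : ContDiff ℝ 2 U) {Λ : NNReal}
    (hLip : LipschitzWith Λ U) (hsym : SymmetricJacobian U) : IsDEPotential U (leading U) := by
  have hG := contDiff_selfForce hU
  have hP : LocO 1 fun η θ => gradient (leading U η) θ :=
    (locO_smul_of_continuous hG.continuous).congr fun η _ θ => by rw [gradient_leading hU hsym]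
  have hDP : LocO 1 fun η θ => fderiv ℝ (gradient (leading U η)) θ :=
    (locO_smul_of_continuous (hG.continuous_fderiv (by norm_num))).congr fun η _ θ => by
      rw [gradient_leading hU hsym, fderiv_fun_const_smul (hG.differentiable (by norm_num) θ)]
  refine ⟨fun η _ => contDiff_leading hU η, hP, hDP, fun N K hK => ?_⟩
  obtain ⟨R, _, hR⟩ := exists_radius hK
  -- One unit of room is for the flow line on [0, N], the other for the one-step expansion started
  -- at a point of it.
  obtain ⟨B, η₁, h1, h1', hB1, hB, hPb⟩ := exists_correction_bounds hU hP hDP (R + 1 + 1)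
  have hB0 : 0 < B := one_pos.trans_le hB.one_le
  refine ⟨N * (1 + Λ : ℝ) ^ N * (16 * B ^ 3), min η₁ (1 / (3 * B * (N + 1))),
    lt_min h1 (by positivity), fun η h2 h3 θ hθ => ?_⟩
  have h4 := h3.trans_le (min_le_left _ _)
  have hη1 : η ≤ 1 := by linarith
  have hηN : η * (3 * B) * N ≤ 1 := by
    have := (lt_div_iff₀ (by positivity)).1 (h3.trans_le (min_le_right _ _))
    nlinarith [mul_pos h2 hB0]
  have hVlt : ∀ x, ‖x‖ ≤ R + 1 → ‖U x + gradient (leading U η) x‖ < 3 * B := fun x hx => by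
    have := norm_add_le (U x) (gradient (leading U η) x)
    have a := (hPb η h2 h4 x (by linarith)).1
    have b := hB.norm_le x (by linarith)
    nlinarith
  have hVc : ContDiff ℝ 1 fun x => U x + gradient (leading U η) x := by
    rw [gradient_leading hU hsym]
    exact (hU.of_le (by norm_num)).add (hG.const_smul _)
  obtain ⟨γ, hγ⟩ := exists_isFlowLine hVc h2 N.cast_nonneg (fun x hx => (hVlt x hx).le) hηN
    (hR θ hθ)
  refine ⟨γ, hγ, ?_⟩
  have hnear : ∀ t : ℕ, t ≤ N → ‖γ t‖ ≤ R + 1 := fun t ht => by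
    have htN : (t : ℝ) ≤ N := by exact_mod_cast ht
    have := hγ.norm_sub_le h2 hVlt (hR θ hθ) hηN t ⟨t.cast_nonneg, htN⟩
    have h5 := norm_add_le (γ t - θ) θ
    rw [sub_add_cancel] at h5
    have : η * (3 * B) * t ≤ η * (3 * B) * N := by gcongr
    linarith [hR θ hθ]
  have hstep : ∀ t : ℕ, t + 1 ≤ N →
      ‖update U η (γ t) - γ (t + 1 : ℕ)‖ ≤ 16 * B ^ 3 * η ^ 3 := by
    intro t ht
    have htN : (t : ℝ) + 1 ≤ N := by exact_mod_cast ht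
    have := (hγ.shift t.cast_nonneg htN).expansion
      (differentiable_gradient (contDiff_leading hU η)) hB
      (fun x hx => (hPb η h2 h4 x hx).1) (fun x hx => (hPb η h2 h4 x hx).2) h2
      (by nlinarith) (hnear t (by omega))
    rw [norm_sub_rev] at this
    -- With ∇φ_η = (η/2)G the two quadratic terms cancel and the Euler step is left.
    have e : γ t - η • U (γ t) - η • gradient (leading U η) (γ t)
        + (η ^ 2 / 2) • selfForce U (γ t) = update U η (γ t) := by
      rw [gradient_leading hU hsym, update]
      module
    rw [e] at this
    rwa [Nat.cast_add, Nat.cast_one]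
  have hupd : ∀ x y, ‖update U η x - update U η y‖ ≤ (1 + Λ) * ‖x - y‖ := fun x y => by
    have e : update U η x - update U η y = (x - y) - η • (U x - U y) := by
      simp only [update]; module
    have l := hLip.dist_le_mul x y
    rw [dist_eq_norm, dist_eq_norm] at l
    rw [e]
    refine (norm_sub_le _ _).trans ?_
    rw [norm_smul, Real.norm_eq_abs, abs_of_pos h2]
    nlinarith [norm_nonneg (U x - U y)]
  -- Solves the recursion e_{t+1} ≤ (1 + Λ)e_t + 16B³η³ with e_0 = 0, with slack that avoids a
  -- geometric sum.
  have hind : ∀ t : ℕ, t ≤ N → ‖(update U η)^[t] θ - γ t‖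
      ≤ t * (1 + Λ : ℝ) ^ t * (16 * B ^ 3) * η ^ 3 := by
    intro t
    induction t with
    | zero => intro _; simp [hγ.1]
    | succ t ih =>
      intro ht
      have i := ih (by omega)
      rw [Function.iterate_succ_apply']
      have a := norm_add_le (update U η ((update U η)^[t] θ) - update U η (γ t))
        (update U η (γ t) - γ (t + 1 : ℕ))
      rw [sub_add_sub_cancel] at a
      have b := hupd ((update U η)^[t] θ) (γ t)
      have c := hstep t ht
      have hΛ : (1 : ℝ) ≤ 1 + Λ := by simp
      have hpow : (1 : ℝ) ≤ (1 + Λ : ℝ) ^ (t + 1) := one_le_pow₀ hΛ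
      calc _ ≤ (1 + Λ) * (t * (1 + Λ : ℝ) ^ t * (16 * B ^ 3) * η ^ 3)
            + 1 * (16 * B ^ 3 * η ^ 3) := by
            have := mul_le_mul_of_nonneg_left i (by positivity : (0 : ℝ) ≤ 1 + Λ)
            linarith
        _ ≤ (1 + Λ) * (t * (1 + Λ : ℝ) ^ t * (16 * B ^ 3) * η ^ 3)
            + (1 + Λ : ℝ) ^ (t + 1) * (16 * B ^ 3 * η ^ 3) := by gcongr
        _ = _ := by push_cast; ring
  intro t ht
  refine (hind t ht).trans ?_
  have hΛ : (1 : ℝ) ≤ 1 + Λ := by simp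
  gcongr


/-! ### Time renormalization -/

/-- One renormalization step adds `(η_{k+1} / 2) J_U U` up to higher order. -/
lemma IsRefinement.step {U : Param d → Param d} (hU : ContDiff ℝ 2 U)
    {V : ℝ → ℕ → Param d → Param d} (hV : IsRefinement U V) (R : ℝ) :
    ∃ D η₀ : ℝ, 0 < η₀ ∧ ∀ η : ℝ, 0 < η → η < η₀ → ∀ k, ∀ θ, ‖θ‖ ≤ R →
      ‖V η (k + 1) θ - V η k θ - (η / 2 ^ (k + 1) / 2) • selfForce U θ‖
        ≤ D * η ^ 2 / 2 / 2 ^ k := by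
  obtain ⟨B, hB⟩ := exists_localBounds hU (R + 1)
  obtain ⟨C₁, η₁, h1, hs⟩ := hV.small _ (isCompact_closedBall (0 : Param d) (R + 1))
  obtain ⟨C₂, η₂, h2, hc⟩ := hV.consistent _ (isCompact_closedBall (0 : Param d) R)
  set S := max B C₁
  have hS : LocalBounds U (R + 1) S := hB.mono (le_max_left _ _)
  have hS1 := hS.one_le
  have hS0 : 0 < S := by linarith
  -- The 7 collects 2 + 4 + 1 from `l1`, `l2`, `l3`, and the 8 is (2h)³/h³ from consistency. Errors
  -- are measured by hη with h = η/2^(k+1), so they are summable in k with total O(η²).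
  refine ⟨(7 * S ^ 3 + 8 * |C₂|) / 2, min (min η₁ η₂) (1 / (2 * S)),
    lt_min (lt_min h1 h2) (by positivity), fun η hη hη' k θ hθ => ?_⟩
  have hlt₁ := hη'.trans_le ((min_le_left _ _).trans (min_le_left _ _))
  have hlt₂ := hη'.trans_le ((min_le_left _ _).trans (min_le_right _ _))
  have hηS : η * (2 * S) ≤ 1 :=
    ((lt_div_iff₀ (by positivity)).1 (hη'.trans_le (min_le_right _ _))).le
  have hη1 : η ≤ 1 := by nlinarith
  set h := η / 2 ^ (k + 1) with hh
  have hpos : 0 < h := by positivity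
  have hhη : h ≤ η := div_le_self hη.le (one_le_pow₀ (by norm_num))
  have h2h : η / 2 ^ k = 2 * h := by rw [hh, pow_succ]; field_simp
  have hθ' : ‖θ‖ ≤ R + 1 := by linarith
  set W := V η (k + 1) with hW
  have hsm : ∀ x, ‖x‖ ≤ R + 1 → ‖W x - U x‖ ≤ S * η ∧
      ‖fderiv ℝ W x - fderiv ℝ U x‖ ≤ S * η := fun x hx => by
    have := hs η hη hlt₁ (k + 1) x (by simpa using hx)
    have hCS : C₁ * η ≤ S * η := by gcongr; exact le_max_right _ _
    exact ⟨this.1.trans hCS, this.2.trans hCS⟩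
  have hWn : ‖W θ‖ ≤ 2 * S := by
    have a := norm_add_le (W θ - U θ) (U θ)
    rw [sub_add_cancel] at a
    nlinarith [(hsm θ hθ').1, hS.norm_le θ hθ']
  set y := θ - h • W θ with hy
  have hyθ : ‖y - θ‖ ≤ 2 * S * h := by
    have : y - θ = -(h • W θ) := by rw [hy]; abel
    rw [this, norm_neg, norm_smul, Real.norm_eq_abs, abs_of_pos hpos]
    nlinarith
  have hyn : ‖y‖ ≤ R + 1 := by
    have a := norm_add_le (y - θ) θ
    rw [sub_add_cancel] at a
    nlinarith
  have l1 : ‖(W y - U y) - (W θ - U θ)‖ ≤ S * η * (2 * S * h) := by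
    refine ((convex_closedBall (0 : Param d) (R + 1)).norm_image_sub_le_of_norm_hasFDerivWithin_le
      (f := fun x => W x - U x) (f' := fun x => fderiv ℝ W x - fderiv ℝ U x) (C := S * η)
      (fun z _ => ((hV.smooth η hη (k + 1) z).hasFDerivAt.sub
        (hU.differentiable (by norm_num) z).hasFDerivAt).hasFDerivWithinAt)
      (fun z hz => (hsm z (by simpa using hz)).2) (by simpa using hθ')
      (by simpa using hyn)).trans ?_
    gcongr
  have l2 : ‖U y - U θ - fderiv ℝ U θ (y - θ)‖ ≤ S * (2 * S * h) ^ 2 :=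
    (hS.taylor θ y hθ' hyn).trans (by gcongr)
  have l3 : ‖h • fderiv ℝ U θ (W θ - U θ)‖ ≤ h * (S * (S * η)) := by
    rw [norm_smul, Real.norm_eq_abs, abs_of_pos hpos]
    gcongr
    exact (fderiv ℝ U θ).le_of_opNorm_le_of_le (hS.fderiv_le θ hθ') (hsm θ hθ').1
  have l4 : ‖W θ + W y - (2 : ℝ) • V η k θ‖ ≤ 8 * |C₂| * h ^ 2 := by
    have a := hc η hη hlt₂ k θ (by simpa using hθ)
    rw [h2h] at a
    have e : update W h (update W h θ) - update (V η k) (2 * h) θ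
        = -(h • (W θ + W y - (2 : ℝ) • V η k θ)) := by
      simp only [update, hy]
      module
    rw [e, norm_neg, norm_smul, Real.norm_eq_abs, abs_of_pos hpos] at a
    refine le_of_mul_le_mul_left (a.trans ?_) hpos
    have : C₂ * (2 * h) ^ 3 ≤ |C₂| * (2 * h) ^ 3 := by gcongr; exact le_abs_self _
    linarith [(by ring : |C₂| * (2 * h) ^ 3 = h * (8 * |C₂| * h ^ 2))]
  -- Consistency says that V_k is nearly the mean of W at θ and at y = θ - hW(θ). Since W(y) is
  -- close to W(θ) - hJ_U U(θ), the difference W - V_k is (h/2)G. The four terms are the errors of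
  -- consistency, of replacing W by U in the increment, of Taylor, and of replacing W by U under
  -- J_U.
  have e : W θ - V η k θ - (h / 2) • selfForce U θ
      = (1 / 2 : ℝ) • ((W θ + W y - (2 : ℝ) • V η k θ) - ((W y - U y) - (W θ - U θ))
        - (U y - U θ - fderiv ℝ U θ (y - θ)) + h • fderiv ℝ U θ (W θ - U θ)) := by
    have : y - θ = -(h • W θ) := by rw [hy]; abel
    rw [this]
    simp only [selfForce, map_neg, map_smul, map_sub]
    module
  rw [e, norm_smul]
  have tri : ∀ a b c e : Param d, ‖a - b - c + e‖ ≤ ‖a‖ + ‖b‖ + ‖c‖ + ‖e‖ := fun a b c e =>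
    (norm_add_le _ _).trans (by
      gcongr
      exact (norm_sub_le _ _).trans (by gcongr; exact norm_sub_le _ _))
  have hhh : h ^ 2 ≤ h * η := by nlinarith
  have hSS : S ^ 2 * (h * η) ≤ S ^ 3 * (h * η) := by gcongr; norm_num
  have hS3 : S ^ 3 * h ^ 2 ≤ S ^ 3 * (h * η) := by gcongr
  have hC3 : |C₂| * h ^ 2 ≤ |C₂| * (h * η) := by gcongr
  calc ‖(1 / 2 : ℝ)‖ * _ ≤ 1 / 2 * ((7 * S ^ 3 + 8 * |C₂|) * (h * η)) := by
        rw [Real.norm_of_nonneg (by norm_num)]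
        gcongr
        refine (tri _ _ _ _).trans ?_
        nlinarith
    _ = (7 * S ^ 3 + 8 * |C₂|) / 2 * η ^ 2 / 2 / 2 ^ k := by
        rw [hh]; field_simp; ring

/-- Subtracting the partial sums (η/2)(1 - 2^(-k))G leaves a sequence that starts at U(θ) and whose
increments are dominated by a geometric series of total Dη². -/
lemma IsRefinement.limit {U : Param d → Param d} (hU : ContDiff ℝ 2 U)
    {V : ℝ → ℕ → Param d → Param d} (hV : IsRefinement U V) (R : ℝ) :
    ∃ D η₀ : ℝ, 0 < η₀ ∧ ∀ η : ℝ, 0 < η → η < η₀ → ∀ θ, ‖θ‖ ≤ R → ∃ W : Param d,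
      Tendsto (fun k => V η k θ) atTop (𝓝 W) ∧
      ‖W - (U θ + (η / 2) • selfForce U θ)‖ ≤ D * η ^ 2 := by
  obtain ⟨D, η₀, h0, hstep⟩ := hV.step hU R
  refine ⟨D, η₀, h0, fun η h1 h2 θ hθ => ?_⟩
  set f : ℕ → Param d := fun k => V η k θ - (η / 2 * (1 - (1 / 2) ^ k)) • selfForce U θ with hf
  have hdist : ∀ k, dist (f k) (f (k + 1)) ≤ D * η ^ 2 / 2 / 2 ^ k := fun k => by
    rw [dist_comm, dist_eq_norm]
    refine (le_of_eq ?_).trans (hstep η h1 h2 k θ hθ)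
    congr 1
    have : η / 2 ^ (k + 1) / 2 = η / 2 * (1 - (1 / 2) ^ (k + 1)) - η / 2 * (1 - (1 / 2) ^ k) := by
      rw [one_div_pow, one_div_pow, pow_succ]; field_simp; ring
    rw [this]
    simp only [hf]
    module
  obtain ⟨a, ha⟩ := cauchySeq_tendsto_of_complete (cauchySeq_of_le_geometric_two hdist)
  have hlim := dist_le_of_le_geometric_two_of_tendsto₀ hdist ha
  refine ⟨a + (η / 2) • selfForce U θ, ?_, ?_⟩
  · have hp : Tendsto (fun k : ℕ => (η / 2 * (1 - (1 / 2 : ℝ) ^ k)) • selfForce U θ) atTop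
        (𝓝 ((η / 2) • selfForce U θ)) := by
      have := tendsto_pow_atTop_nhds_zero_of_lt_one (r := (1 / 2 : ℝ)) (by norm_num) (by norm_num)
      have := ((this.const_sub 1).const_mul (η / 2)).smul_const (selfForce U θ)
      simpa using this
    refine (ha.add hp).congr fun k => ?_
    simp [hf]
  · have h00 : f 0 = U θ := by simp [hf, hV.zero η h1]
    rw [h00, dist_comm, dist_eq_norm] at hlim
    simpa using hlim

lemma IsRefinement.isTRPotential_leading {U : Param d → Param d} (hU : ContDiff ℝ 2 U)
    (hsym : SymmetricJacobian U) {V : ℝ → ℕ → Param d → Param d} (hV : IsRefinement U V) :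
    IsTRPotential U V (leading U) where
  smooth η _ := (contDiff_leading hU η).differentiable (by norm_num)
  limit K hK := by
    obtain ⟨R, _, hR⟩ := exists_radius hK
    obtain ⟨D, η₀, h0, h⟩ := hV.limit hU R
    refine ⟨D, η₀, h0, fun η h1 h2 θ hθ => ?_⟩
    rw [gradient_leading hU hsym]
    exact h η h1 h2 θ (hR θ hθ)

lemma IsTRPotential.eqLeading {U : Param d → Param d} (hU : ContDiff ℝ 2 U)
    (hsym : SymmetricJacobian U) {V : ℝ → ℕ → Param d → Param d} (hV : IsRefinement U V)
    {φ : ℝ → Param d → ℝ} (h : IsTRPotential U V φ) : EqLeadingUpToConst U φ := by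
  refine eqLeadingUpToConst_of_gradient hU hsym h.smooth (locO_of_ball fun R _ => ?_)
  obtain ⟨D, η₁, h1, hD⟩ := hV.limit hU R
  obtain ⟨C, η₂, h2, hC⟩ := h.limit _ (isCompact_closedBall (0 : Param d) R)
  refine ⟨D + C, min η₁ η₂, lt_min h1 h2, fun η h3 h4 θ hθ => ?_⟩
  obtain ⟨W, hW, hW'⟩ := hD η h3 (h4.trans_le (min_le_left _ _)) θ hθ
  obtain ⟨W₂, hW₂, hW₂'⟩ := hC η h3 (h4.trans_le (min_le_right _ _)) θ (by simpa using hθ)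
  obtain rfl := tendsto_nhds_unique hW hW₂
  have e : gradient (φ η) θ - (η / 2) • selfForce U θ
      = (W - (U θ + (η / 2) • selfForce U θ)) - (W - (U θ + gradient (φ η) θ)) := by abel
  rw [e, add_mul]
  exact (norm_sub_le _ _).trans (add_le_add hW' hW₂')

/-! A refinement is obtained by transporting `U` along itself: `W(θ) = U(θ + c W(θ))`. -/

/-- The map id - cU differs from the identity by a map with Lipschitz constant cΛ < 1, so it is a
homeomorphism, and W is U composed with its inverse. The inverse is differentiable because 1 - cJ_U
is invertible by the Neumann series. -/
lemma exists_transported {U : Param d → Param d} (hU : Differentiable ℝ U) {Λ : NNReal}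
    (hLip : LipschitzWith Λ U) {c : ℝ} (hc : 0 ≤ c) (hcΛ : c * Λ < 1) :
    ∃ W : Param d → Param d, Differentiable ℝ W ∧ ∀ θ, W θ = U (θ + c • W θ) := by
  lift c to NNReal using hc
  set S : Param d → Param d := fun x => x - (c : ℝ) • U x with hS
  have hclt : c * Λ < 1 := by exact_mod_cast hcΛ
  have happrox : ApproximatesLinearOn S
      ((ContinuousLinearEquiv.refl ℝ (Param d) : Param d ≃L[ℝ] Param d) :
        Param d →L[ℝ] Param d) Set.univ (c * Λ) := by
    intro x _ y _
    have e : S x - S y - ((ContinuousLinearEquiv.refl ℝ (Param d) : Param d ≃L[ℝ] Param d) :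
        Param d →L[ℝ] Param d) (x - y) = -((c : ℝ) • (U x - U y)) := by
      simp only [hS, ContinuousLinearEquiv.coe_refl, ContinuousLinearMap.id_apply]
      module
    have l := hLip.dist_le_mul x y
    rw [dist_eq_norm, dist_eq_norm] at l
    rw [e, norm_neg, norm_smul, NNReal.coe_mul, Real.norm_of_nonneg c.coe_nonneg, mul_assoc]
    gcongr
  have hcond : Subsingleton (Param d) ∨
      c * Λ < ‖((ContinuousLinearEquiv.refl ℝ (Param d)).symm : Param d →L[ℝ] Param d)‖₊⁻¹ := by
    rcases subsingleton_or_nontrivial (Param d) with h | h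
    · exact Or.inl h
    · right
      rw [ContinuousLinearEquiv.refl_symm, ContinuousLinearEquiv.coe_refl,
        ContinuousLinearMap.nnnorm_id, inv_one]
      exact hclt
  set e := happrox.toHomeomorph S hcond with he
  have heS : ∀ x, S (e.symm x) = x := fun x => e.apply_symm_apply x
  refine ⟨fun θ => U (e.symm θ), ?_, fun θ => ?_⟩
  · refine hU.comp fun θ => ?_
    set A : Param d →L[ℝ] Param d := (c : ℝ) • fderiv ℝ U (e.symm θ) with hA
    have hAn : ‖A‖ < 1 := by
      rw [hA, norm_smul, Real.norm_of_nonneg c.coe_nonneg]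
      refine lt_of_le_of_lt ?_ hcΛ
      gcongr
      exact norm_fderiv_le_of_lipschitz ℝ hLip
    set u := Units.oneSub A hAn with hu
    set f' := ContinuousLinearEquiv.ofUnit u with hf'
    have hd : HasFDerivAt S (f' : Param d →L[ℝ] Param d) (e.symm θ) := by
      exact (hasFDerivAt_id (𝕜 := ℝ) (e.symm θ)).sub
        ((hU (e.symm θ)).hasFDerivAt.const_smul (c : ℝ))
    exact (hd.of_local_left_inverse e.symm.continuous.continuousAt
      (Eventually.of_forall heS)).differentiableAt
  · have := heS θ
    simp only [hS] at this
    exact congrArg U (sub_eq_iff_eq_add.1 this)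

section Transported

variable {U W : Param d → Param d} {Λ : NNReal} {c : ℝ}

lemma fderiv_transported (hU : Differentiable ℝ U) (hW : Differentiable ℝ W)
    (hWU : ∀ θ, W θ = U (θ + c • W θ)) (θ : Param d) :
    fderiv ℝ W θ = (fderiv ℝ U (θ + c • W θ)).comp
      (ContinuousLinearMap.id ℝ (Param d) + c • fderiv ℝ W θ) := by
  have h1 : HasFDerivAt (fun θ => U (θ + c • W θ)) ((fderiv ℝ U (θ + c • W θ)).comp
      (ContinuousLinearMap.id ℝ (Param d) + c • fderiv ℝ W θ)) θ :=
    (hU _).hasFDerivAt.comp θ ((hasFDerivAt_id θ).add ((hW θ).hasFDerivAt.const_smul c))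
  rw [← funext hWU] at h1
  exact h1.fderiv

/-- The Jacobian D of W satisfies D = J + cJD with J symmetric, so formally D = (1 - cJ)⁻¹J.
Substituting the relation on both sides proves symmetry without the inverse. -/
lemma symmetricJacobian_transported (hU : Differentiable ℝ U) (hsym : SymmetricJacobian U)
    (hW : Differentiable ℝ W) (hWU : ∀ θ, W θ = U (θ + c • W θ)) : SymmetricJacobian W := by
  intro θ a b
  have hD : ∀ v, fderiv ℝ W θ v = fderiv ℝ U (θ + c • W θ) v
      + c • fderiv ℝ U (θ + c • W θ) (fderiv ℝ W θ v) := fun v => by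
    conv_lhs => rw [fderiv_transported hU hW hWU θ]
    simp
  have hJ : ∀ v w, inner ℝ (fderiv ℝ U (θ + c • W θ) v) w
      = inner ℝ v (fderiv ℝ U (θ + c • W θ) w) := fun v w => hsym _ v w
  set J := fderiv ℝ U (θ + c • W θ)
  set D := fderiv ℝ W θ
  change inner ℝ (D a) b = inner ℝ a (D b)
  have hJD : ∀ v w, inner ℝ (D v) (J w) = inner ℝ (D v) (D w) - c * inner ℝ (D v) (J (D w)) := by
    intro v w
    have : J w = D w - c • J (D w) := by rw [eq_sub_iff_add_eq]; exact (hD w).symm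
    conv_lhs => rw [this]
    rw [inner_sub_right, real_inner_smul_right]
  rw [hD a, hD b, inner_add_left, inner_add_right, real_inner_smul_left, real_inner_smul_right,
    hJ a b, hJ (D a) b, hJD a b, ← hJ a (D b), real_inner_comm (D b) (J a), hJD b a,
    real_inner_comm (D a) (D b), real_inner_comm (J (D a)) (D b), hJ (D a) (D b)]

/-- Absorption: ‖W - U‖ ≤ cΛ‖W‖ ≤ ½‖W‖. -/
lemma norm_transported_le (hLip : LipschitzWith Λ U) (hc : 0 ≤ c) (hcΛ : c * Λ ≤ 1 / 2)
    (hWU : ∀ θ, W θ = U (θ + c • W θ)) (θ : Param d) : ‖W θ‖ ≤ 2 * ‖U θ‖ := by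
  have l := hLip.dist_le_mul (θ + c • W θ) θ
  rw [dist_eq_norm, dist_eq_norm, ← hWU, add_sub_cancel_left, norm_smul,
    Real.norm_of_nonneg hc] at l
  have a := norm_add_le (W θ - U θ) (U θ)
  rw [sub_add_cancel] at a
  nlinarith [norm_nonneg (W θ)]

lemma transported_sub_le {R B : ℝ} (hU : Differentiable ℝ U) (hLip : LipschitzWith Λ U)
    (hB : LocalBounds U (R + 1) B) (hΛB : Λ ≤ B) (hc : 0 ≤ c) (hcΛ : c * Λ ≤ 1 / 2)
    (hcB : c * (2 * B) ≤ 1) (hW : Differentiable ℝ W)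
    (hWU : ∀ θ, W θ = U (θ + c • W θ)) {θ : Param d} (hθ : ‖θ‖ ≤ R) :
    ‖W θ - U θ‖ ≤ 4 * B ^ 2 * c ∧ ‖fderiv ℝ W θ - fderiv ℝ U θ‖ ≤ 4 * B ^ 2 * c := by
  have hB0 : 0 < B := one_pos.trans_le hB.one_le
  have hθ' : ‖θ‖ ≤ R + 1 := by linarith
  have hWn : ‖W θ‖ ≤ 2 * B :=
    (norm_transported_le hLip hc hcΛ hWU θ).trans (by linarith [hB.norm_le θ hθ'])
  have hcW : ‖c • W θ‖ ≤ c * (2 * B) := by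
    rw [norm_smul, Real.norm_of_nonneg hc]; gcongr
  have hx : ‖θ + c • W θ‖ ≤ R + 1 := (norm_add_le _ _).trans (by linarith)
  have l1 := hB.lip θ (θ + c • W θ) hθ' hx
  have l2 := hB.fderiv_lip θ (θ + c • W θ) hθ' hx
  rw [add_sub_cancel_left] at l1 l2
  rw [← hWU] at l1
  have l3 : B * ‖c • W θ‖ ≤ B * (c * (2 * B)) := by gcongr
  refine ⟨by nlinarith [mul_nonneg hc (sq_nonneg B)], ?_⟩
  have hD := fderiv_transported hU hW hWU θ
  have hJn : ‖fderiv ℝ U (θ + c • W θ)‖ ≤ Λ := norm_fderiv_le_of_lipschitz ℝ hLip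
  set J := fderiv ℝ U (θ + c • W θ)
  set D := fderiv ℝ W θ
  have hD' : D - J = c • J.comp D := by
    conv_lhs => rw [hD]
    ext v
    simp
  have hJD : ‖c • J.comp D‖ ≤ c * Λ * ‖D‖ := by
    rw [norm_smul, Real.norm_of_nonneg hc, mul_assoc]
    gcongr
    exact (J.opNorm_comp_le D).trans (by gcongr)
  have hDn : ‖D‖ ≤ 2 * B := by
    have a := norm_add_le (D - J) J
    rw [sub_add_cancel, hD'] at a
    nlinarith [norm_nonneg D]
  have a := norm_add_le (D - J) (J - fderiv ℝ U θ)
  rw [sub_add_sub_cancel, hD'] at a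
  have b : c * Λ * ‖D‖ ≤ c * B * (2 * B) := by gcongr
  nlinarith

/-- Two half steps of the transported field against one step of the field transported less far. -/
lemma transported_two_step {R B h : ℝ} {W' : Param d → Param d} (hLip : LipschitzWith Λ U)
    (hB : LocalBounds U (R + 1 + 1) B) (hΛB : Λ ≤ B) (hh : 0 ≤ h) (hhc : h / 2 ≤ c)
    (hcΛ : c * Λ ≤ 1 / 2) (hcB : c * (2 * B) ≤ 1) (hhB : h * (2 * B) ≤ 1)
    (hWU : ∀ θ, W θ = U (θ + c • W θ)) (hWU' : ∀ θ, W' θ = U (θ + (c - h / 2) • W' θ))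
    {θ : Param d} (hθ : ‖θ‖ ≤ R) :
    ‖update W h (update W h θ) - update W' (2 * h) θ‖ ≤ 52 * B ^ 3 * h ^ 3 := by
  have hB0 : 0 < B := one_pos.trans_le hB.one_le
  have hΛ0 : (0 : ℝ) ≤ Λ := Λ.coe_nonneg
  have hc : 0 ≤ c := by linarith
  have hc' : 0 ≤ c - h / 2 := by linarith
  have hWn : ∀ x, ‖x‖ ≤ R + 1 + 1 → ‖W x‖ ≤ 2 * B := fun x hx =>
    (norm_transported_le hLip hc hcΛ hWU x).trans (by linarith [hB.norm_le x hx])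
  have hWn' : ‖W' θ‖ ≤ 2 * B :=
    (norm_transported_le hLip hc' (by nlinarith) hWU' θ).trans
      (by linarith [hB.norm_le θ (by linarith)])
  have hsm : ∀ (s : ℝ) (v : Param d), 0 ≤ s → s * (2 * B) ≤ 1 → ‖v‖ ≤ 2 * B → ‖s • v‖ ≤ 1 :=
    fun s v h1 h2 h3 => by
      rw [norm_smul, Real.norm_of_nonneg h1]
      exact (mul_le_mul_of_nonneg_left h3 h1).trans h2
  set a := W θ with ha
  have han : ‖a‖ ≤ 2 * B := hWn θ (by linarith)
  set θ₁ := θ - h • a with hθ₁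
  have hθ₁n : ‖θ₁‖ ≤ R + 1 := (norm_sub_le _ _).trans (by linarith [hsm h a hh hhB han])
  set x := θ + c • a with hx
  set y := θ + (c - h / 2) • W' θ with hy
  set z := θ₁ + c • W θ₁ with hz
  have hxn : ‖x‖ ≤ R + 1 + 1 := (norm_add_le _ _).trans (by linarith [hsm c a hc hcB han])
  have hyn : ‖y‖ ≤ R + 1 + 1 := (norm_add_le _ _).trans
    (by linarith [hsm _ _ hc' (by nlinarith) hWn'])
  have hzn : ‖z‖ ≤ R + 1 + 1 := (norm_add_le _ _).trans
    (by linarith [hsm c _ hc hcB (hWn θ₁ (by linarith))])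
  have eUx : U x = a := (hWU θ).symm
  have eUy : U y = W' θ := (hWU' θ).symm
  have eUz : U z = W θ₁ := (hWU θ₁).symm
  set E := W θ₁ - a with hE
  set F := W' θ - a with hF
  have ezx : z - x = c • E - h • a := by
    simp only [hz, hx, hθ₁, hE]; module
  have eyx : y - x = c • F - (h / 2) • W' θ := by
    simp only [hy, hx, hF]; module
  have lz := hLip.dist_le_mul z x
  have ly := hLip.dist_le_mul y x
  rw [dist_eq_norm, dist_eq_norm, eUz, eUx, ← hE] at lz
  rw [dist_eq_norm, dist_eq_norm, eUy, eUx, ← hF] at ly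
  have nz : ‖z - x‖ ≤ c * ‖E‖ + h * (2 * B) := by
    rw [ezx]
    refine (norm_sub_le _ _).trans ?_
    rw [norm_smul, norm_smul, Real.norm_of_nonneg hc, Real.norm_of_nonneg hh]
    gcongr
  have ny : ‖y - x‖ ≤ c * ‖F‖ + h / 2 * (2 * B) := by
    rw [eyx]
    refine (norm_sub_le _ _).trans ?_
    rw [norm_smul, norm_smul, Real.norm_of_nonneg hc, Real.norm_of_nonneg (by positivity)]
    gcongr
  -- Since cΛ ≤ 1/2, the implicit terms c‖E‖ and c‖F‖ can be absorbed into the left sides of `nz`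
  -- and `ny`.
  have cE : c * ‖E‖ ≤ 1 / 2 * ‖z - x‖ := by
    calc c * ‖E‖ ≤ c * (Λ * ‖z - x‖) := by gcongr
      _ = c * Λ * ‖z - x‖ := by ring
      _ ≤ _ := by gcongr
  have cF : c * ‖F‖ ≤ 1 / 2 * ‖y - x‖ := by
    calc c * ‖F‖ ≤ c * (Λ * ‖y - x‖) := by gcongr
      _ = c * Λ * ‖y - x‖ := by ring
      _ ≤ _ := by gcongr
  have nz' : ‖z - x‖ ≤ 4 * B * h := by linarith
  have ny' : ‖y - x‖ ≤ 2 * B * h := by linarith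
  have nF : ‖F‖ ≤ B * (2 * B * h) := ly.trans (by gcongr)
  have tz := hB.taylor x z hxn hzn
  have ty := hB.taylor x y hxn hyn
  have hJn : ‖fderiv ℝ U x‖ ≤ Λ := norm_fderiv_le_of_lipschitz ℝ hLip
  -- The two-step defect is -h(E - 2F). By Taylor at x, E - 2F equals J_U applied to c(E - 2F) + hF,
  -- up to O(h²). The shift by h/2 is what cancels the terms linear in h. Absorbing half of ‖E - 2F‖
  -- gives 52 = 2(16 + 8 + 2).
  have e : E - (2 : ℝ) • F = (U z - U x - fderiv ℝ U x (z - x))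
      - (2 : ℝ) • (U y - U x - fderiv ℝ U x (y - x))
      + fderiv ℝ U x (c • (E - (2 : ℝ) • F) + h • F) := by
    have : c • (E - (2 : ℝ) • F) + h • F = (z - x) - (2 : ℝ) • (y - x) := by
      rw [ezx, eyx]
      simp only [hF]
      module
    rw [this, map_sub _ (z - x), map_smul, eUx, eUy, eUz]
    simp only [hE, hF]
    module
  have n1 : ‖U z - U x - fderiv ℝ U x (z - x)‖ ≤ B * (4 * B * h) ^ 2 := tz.trans (by gcongr)
  have n2 : ‖(2 : ℝ) • (U y - U x - fderiv ℝ U x (y - x))‖ ≤ 2 * (B * (2 * B * h) ^ 2) := by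
    rw [norm_smul, Real.norm_ofNat]
    gcongr
    exact ty.trans (by gcongr)
  have n3 : ‖fderiv ℝ U x (c • (E - (2 : ℝ) • F) + h • F)‖
      ≤ 1 / 2 * ‖E - (2 : ℝ) • F‖ + B * (h * (B * (2 * B * h))) := by
    refine ((fderiv ℝ U x).le_of_opNorm_le_of_le hJn (norm_add_le _ _)).trans ?_
    rw [norm_smul, norm_smul, Real.norm_of_nonneg hc, Real.norm_of_nonneg hh, mul_add,
      ← mul_assoc, mul_comm (Λ : ℝ) c]
    gcongr
  have n4 : ‖E - (2 : ℝ) • F‖ ≤ B * (4 * B * h) ^ 2 + 2 * (B * (2 * B * h) ^ 2)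
      + (1 / 2 * ‖E - (2 : ℝ) • F‖ + B * (h * (B * (2 * B * h)))) := by
    conv_lhs => rw [e]
    exact (norm_add_le _ _).trans (add_le_add ((norm_sub_le _ _).trans (add_le_add n1 n2)) n3)
  have e2 : update W h (update W h θ) - update W' (2 * h) θ = -(h • (E - (2 : ℝ) • F)) := by
    simp only [update, ← ha, ← hθ₁, hE, hF]
    rw [hθ₁]
    module
  rw [e2, norm_neg, norm_smul, Real.norm_of_nonneg hh]
  calc h * ‖E - (2 : ℝ) • F‖ ≤ h * (52 * B ^ 3 * h ^ 2) := by
        gcongr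
        nlinarith
    _ = _ := by ring

end Transported

/-- U_k is U transported by c_k = (η/2)(1 - 2^(-k)), so that c_0 = 0 and c_{k+1} - c_k = η_{k+1}/2,
the shift required by `transported_two_step`. -/
lemma exists_symmetric_refinement {U : Param d → Param d} (hU : ContDiff ℝ 2 U) {Λ : NNReal}
    (hLip : LipschitzWith Λ U) (hsym : SymmetricJacobian U) :
    ∃ V : ℝ → ℕ → Param d → Param d, IsRefinement U V ∧
      ∀ η : ℝ, 0 < η → ∀ k, SymmetricJacobian (V η k) := by
  have hd : Differentiable ℝ U := hU.differentiable (by norm_num)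
  set c : ℝ → ℕ → ℝ := fun η k => η / 2 * (1 - (1 / 2) ^ k) with hcdef
  have hc0 : ∀ η, 0 < η → ∀ k, 0 ≤ c η k := fun η hη k =>
    mul_nonneg (by positivity) (sub_nonneg.2 (pow_le_one₀ (by norm_num) (by norm_num)))
  have hcη : ∀ η, 0 < η → ∀ k, c η k ≤ η / 2 := fun η hη k =>
    mul_le_of_le_one_right (by positivity) (by simp)
  have hex : ∀ (η : ℝ) (k : ℕ), ∃ W : Param d → Param d, 0 < η →
      Differentiable ℝ W ∧ SymmetricJacobian W ∧
      (k = 0 → W = U) ∧ (η * Λ ≤ 1 → ∀ θ, W θ = U (θ + c η k • W θ)) := by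
    intro η k
    by_cases h : 0 < η ∧ η * Λ ≤ 1
    · have hcΛ : c η k * Λ < 1 := by
        have := mul_le_mul_of_nonneg_right (hcη η h.1 k) Λ.coe_nonneg
        linarith [h.2]
      obtain ⟨W, hW, hWU⟩ := exists_transported hd hLip (hc0 η h.1 k) hcΛ
      refine ⟨W, fun _ => ⟨hW, symmetricJacobian_transported hd hsym hW hWU, ?_, fun _ => hWU⟩⟩
      rintro rfl
      funext θ
      rw [hWU]
      simp [hcdef]
    -- For ηΛ > 1 the transport equation may be unsolvable. U itself is used, since the estimates
    -- concern only small η.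
    · exact ⟨U, fun hη => ⟨hd, hsym, fun _ => rfl, fun h' => absurd ⟨hη, h'⟩ h⟩⟩
  choose V hV using hex
  refine ⟨V, ⟨fun η hη => (hV η 0 hη).2.2.1 rfl, fun η hη k => (hV η k hη).1, ?_, ?_⟩,
    fun η hη k => (hV η k hη).2.1⟩
  · intro K hK
    obtain ⟨R, _, hR⟩ := exists_radius hK
    obtain ⟨B₀, hB₀⟩ := exists_localBounds hU (R + 1)
    have hB := hB₀.mono (le_max_left B₀ Λ)
    have hΛB : (Λ : ℝ) ≤ max B₀ Λ := le_max_right _ _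
    set B := max B₀ Λ
    have hB0 : 0 < B := one_pos.trans_le hB.one_le
    refine ⟨4 * B ^ 2, 1 / (2 * B), by positivity, fun η h1 h2 k θ hθ => ?_⟩
    have hηB : η * (2 * B) ≤ 1 := ((lt_div_iff₀ (by positivity)).1 h2).le
    have hηΛ : η * Λ ≤ η * B := by gcongr
    have hcΛ : c η k * Λ ≤ η / 2 * Λ := by gcongr; exact hcη η h1 k
    have hcB : c η k * (2 * B) ≤ η / 2 * (2 * B) := by gcongr; exact hcη η h1 k
    have := transported_sub_le hd hLip hB hΛB (hc0 η h1 k) (by linarith) (by linarith)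
      (hV η k h1).1 ((hV η k h1).2.2.2 (by nlinarith)) (hR θ hθ)
    have h4 : 4 * B ^ 2 * c η k ≤ 4 * B ^ 2 * η := by
      gcongr
      linarith [hcη η h1 k]
    exact ⟨this.1.trans h4, this.2.trans h4⟩
  · intro K hK
    obtain ⟨R, _, hR⟩ := exists_radius hK
    obtain ⟨B₀, hB₀⟩ := exists_localBounds hU (R + 1 + 1)
    have hB := hB₀.mono (le_max_left B₀ Λ)
    have hΛB : (Λ : ℝ) ≤ max B₀ Λ := le_max_right _ _
    set B := max B₀ Λ
    have hB0 : 0 < B := one_pos.trans_le hB.one_le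
    refine ⟨52 * B ^ 3, 1 / (2 * B), by positivity, fun η h1 h2 k θ hθ => ?_⟩
    have hηB : η * (2 * B) ≤ 1 := ((lt_div_iff₀ (by positivity)).1 h2).le
    have hηΛ : η * Λ ≤ η * B := by gcongr
    have hcΛ : c η (k + 1) * Λ ≤ η / 2 * Λ := by gcongr; exact hcη η h1 _
    have hcB : c η (k + 1) * (2 * B) ≤ η / 2 * (2 * B) := by gcongr; exact hcη η h1 _
    set h := η / 2 ^ (k + 1) with hh
    have hpos : 0 < h := by positivity
    have hhη : h ≤ η := div_le_self h1.le (one_le_pow₀ (by norm_num))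
    have h2h : η / 2 ^ k = 2 * h := by rw [hh, pow_succ]; field_simp
    have hck : c η k = c η (k + 1) - h / 2 := by
      simp only [hcdef, hh, one_div_pow, pow_succ]
      field_simp
      ring
    have hWk := (hV η k h1).2.2.2 (by nlinarith)
    rw [hck] at hWk
    have := transported_two_step hLip hB hΛB hpos.le (by linarith [hc0 η h1 k]) (by linarith)
      (by linarith) (by nlinarith) ((hV η (k + 1) h1).2.2.2 (by nlinarith)) hWk (hR θ hθ)
    rw [h2h]
    refine this.trans ?_
    gcongr
    linarith


/-! ### Gaussian laws -/

lemma gaussDensity_pos (m : Param d) {v : ℝ} (hv : 0 < v) (x : Param d) :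
    0 < gaussDensity m v x := by
  unfold gaussDensity; positivity

lemma continuous_gaussDensity (v : ℝ) :
    Continuous fun p : Param d × Param d => gaussDensity p.1 v p.2 := by
  unfold gaussDensity; fun_prop

lemma measurable_ofReal_gaussDensity (m : Param d) (v : ℝ) :
    Measurable fun x => ENNReal.ofReal (gaussDensity m v x) :=
  ((continuous_gaussDensity v).comp
    (by fun_prop : Continuous fun x => (m, x))).measurable.ennreal_ofReal

lemma gaussDensity_le (m : Param d) {v : ℝ} (hv : 0 < v) (x : Param d) :
    gaussDensity m v x ≤ (2 * Real.pi * v) ^ (-(d : ℝ) / 2) := by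
  refine mul_le_of_le_one_right (by positivity) (Real.exp_le_one_iff.2 ?_)
  rw [neg_div]
  exact neg_nonpos.2 (by positivity)

/-- From ‖x - m‖² ≤ 2‖m‖² + 2‖x‖². The bound factors into a function of m and one of x, so it
survives averaging over m. -/
lemma le_gaussDensity (m : Param d) {v : ℝ} (hv : 0 < v) (x : Param d) :
    (2 * Real.pi * v) ^ (-(d : ℝ) / 2) * (Real.exp (-(‖m‖ ^ 2 / v)) * Real.exp (-(v⁻¹ * ‖x‖ ^ 2)))
      ≤ gaussDensity m v x := by
  unfold gaussDensity
  rw [← Real.exp_add]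
  gcongr
  have h : ‖x - m‖ ^ 2 ≤ 2 * (‖m‖ ^ 2 + ‖x‖ ^ 2) := by
    nlinarith [norm_sub_le x m, norm_nonneg (x - m), sq_nonneg (‖x‖ - ‖m‖)]
  calc -(‖m‖ ^ 2 / v) + -(v⁻¹ * ‖x‖ ^ 2) = -(2 * (‖m‖ ^ 2 + ‖x‖ ^ 2)) / (2 * v) := by
        field_simp; ring
    _ ≤ -‖x - m‖ ^ 2 / (2 * v) := by gcongr

/-- If integrability failed, the Bochner integral would be 0 by convention, against its known
positive value. -/
lemma integrable_exp_neg_mul_norm_sq {b : ℝ} (hb : 0 < b) :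
    Integrable fun x : Param d => Real.exp (-b * ‖x‖ ^ 2) := by
  by_contra h
  have h1 := GaussianFourier.integral_rexp_neg_mul_sq_norm (V := Param d) hb
  rw [integral_undef h] at h1
  have : 0 < (Real.pi / b) ^ ((Module.finrank ℝ (Param d) : ℝ) / 2) := by positivity
  linarith

lemma gaussDensity_zero_one (x : Param d) : gaussDensity 0 1 x
    = (2 * Real.pi) ^ (-(d : ℝ) / 2) * Real.exp (-(1 / 2) * ‖x‖ ^ 2) := by
  simp only [gaussDensity, sub_zero, mul_one]
  congr 2
  ring

lemma integrable_gaussDensity_zero_one : Integrable (gaussDensity (0 : Param d) 1) := by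
  rw [funext gaussDensity_zero_one]
  exact (integrable_exp_neg_mul_norm_sq (by norm_num)).const_mul _

lemma integral_gaussDensity_zero_one : ∫ x : Param d, gaussDensity 0 1 x = 1 := by
  rw [funext gaussDensity_zero_one, integral_const_mul,
    GaussianFourier.integral_rexp_neg_mul_sq_norm (by norm_num), finrank_euclideanSpace_fin,
    (by ring : Real.pi / (1 / 2) = 2 * Real.pi), ← Real.rpow_add (by positivity)]
  ring_nf
  exact Real.rpow_zero _

instance isProbabilityMeasure_gauss_zero_one : IsProbabilityMeasure (gauss (0 : Param d) 1) := by
  constructor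
  rw [gauss, withDensity_apply _ MeasurableSet.univ, Measure.restrict_univ,
    ← ofReal_integral_eq_lintegral_ofReal integrable_gaussDensity_zero_one
      (Eventually.of_forall fun x => (gaussDensity_pos 0 one_pos x).le),
    integral_gaussDensity_zero_one, ENNReal.ofReal_one]

lemma integrable_norm_sq_gauss_zero_one :
    Integrable (fun x : Param d => ‖x‖ ^ 2) (gauss 0 1) := by
  rw [gauss, integrable_withDensity_iff (measurable_ofReal_gaussDensity 0 1)
    (Eventually.of_forall fun _ => ENNReal.ofReal_lt_top)]
  -- The inequality ‖x‖² ≤ 4 exp(‖x‖²/4) spends half of the Gaussian exponent 1/2, and 1/4 remains.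
  have hi := ((integrable_exp_neg_mul_norm_sq (d := d) (b := 1 / 4) (by norm_num)).const_mul
    (4 * (2 * Real.pi) ^ (-(d : ℝ) / 2)))
  refine hi.mono' ?_ (Eventually.of_forall fun x => ?_)
  · exact ((by fun_prop : Continuous fun x : Param d => ‖x‖ ^ 2).measurable.mul
      (measurable_ofReal_gaussDensity 0 1).ennreal_toReal).aestronglyMeasurable
  · rw [ENNReal.toReal_ofReal (gaussDensity_pos 0 one_pos x).le,
      Real.norm_of_nonneg (mul_nonneg (by positivity) (gaussDensity_pos 0 one_pos x).le),
      gaussDensity_zero_one]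
    have h1 : ‖x‖ ^ 2 ≤ 4 * Real.exp (1 / 4 * ‖x‖ ^ 2) := by
      linarith [Real.add_one_le_exp (1 / 4 * ‖x‖ ^ 2)]
    calc ‖x‖ ^ 2 * ((2 * Real.pi) ^ (-(d : ℝ) / 2) * Real.exp (-(1 / 2) * ‖x‖ ^ 2))
        ≤ 4 * Real.exp (1 / 4 * ‖x‖ ^ 2)
          * ((2 * Real.pi) ^ (-(d : ℝ) / 2) * Real.exp (-(1 / 2) * ‖x‖ ^ 2)) := by gcongr
      _ = 4 * (2 * Real.pi) ^ (-(d : ℝ) / 2)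
          * (Real.exp (1 / 4 * ‖x‖ ^ 2) * Real.exp (-(1 / 2) * ‖x‖ ^ 2)) := by ring
      _ = _ := by rw [← Real.exp_add]; congr 2; ring

lemma gaussDensity_affine (m : Param d) {s : ℝ} (hs : 0 < s) (x : Param d) :
    s ^ d * gaussDensity m (s ^ 2) (m + s • x) = gaussDensity 0 1 x := by
  rw [gaussDensity_zero_one, gaussDensity, add_sub_cancel_left, norm_smul,
    Real.norm_of_nonneg hs.le, Real.mul_rpow (by positivity) (by positivity),
    ← Real.rpow_natCast s 2, ← Real.rpow_mul hs.le,
    ← Real.rpow_natCast s d]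
  have h1 : s ^ (d : ℝ) * s ^ (((2 : ℕ) : ℝ) * (-(d : ℝ) / 2)) = 1 := by
    rw [← Real.rpow_add hs]
    push_cast
    ring_nf
    exact Real.rpow_zero _
  have h2 : -(s * ‖x‖) ^ 2 / (2 * s ^ ((2 : ℕ) : ℝ)) = -(1 / 2) * ‖x‖ ^ 2 := by
    rw [Real.rpow_natCast]
    field_simp
  rw [h2]
  linear_combination ((2 * Real.pi) ^ (-(d : ℝ) / 2) * Real.exp (-(1 / 2) * ‖x‖ ^ 2)) * h1

lemma lintegral_affine {f : Param d → ENNReal} (hf : Measurable f) (m : Param d) {s : ℝ}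
    (hs : 0 < s) :
    ∫⁻ y, f y = ENNReal.ofReal (s ^ d) * ∫⁻ x, f (m + s • x) := by
  have h1 : ∫⁻ x, f (m + s • x) = ENNReal.ofReal (s ^ d)⁻¹ * ∫⁻ y, f y := by
    have h := lintegral_map (μ := (volume : Measure (Param d)))
      (hf.comp (measurable_const_add m)) (measurable_const_smul s)
    rw [Measure.map_addHaar_smul _ hs.ne', lintegral_smul_measure, finrank_euclideanSpace_fin,
      abs_of_pos (by positivity)] at h
    simp only [Function.comp_apply] at h
    rw [← h, lintegral_add_left_eq_self f m, smul_eq_mul]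
  rw [h1, ← mul_assoc, ← ENNReal.ofReal_mul (by positivity),
    mul_inv_cancel₀ (by positivity), ENNReal.ofReal_one, one_mul]

lemma lintegral_gauss_sq (m : Param d) {s : ℝ} (hs : 0 < s) {f : Param d → ENNReal}
    (hf : Measurable f) : ∫⁻ y, f y ∂gauss m (s ^ 2) = ∫⁻ x, f (m + s • x) ∂gauss 0 1 := by
  rw [gauss, gauss,
    lintegral_withDensity_eq_lintegral_mul _ (measurable_ofReal_gaussDensity _ _) hf,
    lintegral_withDensity_eq_lintegral_mul _ (measurable_ofReal_gaussDensity _ _)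
      (by fun_prop : Measurable fun x => f (m + s • x)),
    lintegral_affine ((measurable_ofReal_gaussDensity _ _).mul hf) m hs,
    ← lintegral_const_mul _ (by
      exact ((measurable_ofReal_gaussDensity _ _).mul hf).comp (by fun_prop))]
  refine lintegral_congr fun x => ?_
  simp only [Pi.mul_apply, ← gaussDensity_affine m hs x]
  rw [← mul_assoc, ← ENNReal.ofReal_mul (by positivity)]

lemma gauss_sq_eq_map (m : Param d) {s : ℝ} (hs : 0 < s) :
    gauss m (s ^ 2) = (gauss 0 1).map fun x => m + s • x := by
  refine Measure.ext_of_lintegral _ fun f hf => ?_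
  rw [lintegral_gauss_sq m hs hf, lintegral_map hf (by fun_prop)]

lemma gauss_eq_map (m : Param d) {v : ℝ} (hv : 0 < v) :
    gauss m v = (gauss 0 1).map fun x => m + √v • x := by
  rw [← gauss_sq_eq_map m (Real.sqrt_pos.2 hv), Real.sq_sqrt hv.le]

lemma isProbabilityMeasure_gauss (m : Param d) {v : ℝ} (hv : 0 < v) :
    IsProbabilityMeasure (gauss m v) := by
  rw [gauss_eq_map m hv]
  exact Measure.isProbabilityMeasure_map (by fun_prop)

lemma norm_add_smul_sq_le (m x : Param d) (s : ℝ) :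
    ‖m + s • x‖ ^ 2 ≤ 2 * ‖m‖ ^ 2 + 2 * s ^ 2 * ‖x‖ ^ 2 := by
  have h := norm_add_le m (s • x)
  have h2 : ‖s • x‖ ^ 2 = s ^ 2 * ‖x‖ ^ 2 := by rw [norm_smul, mul_pow, Real.norm_eq_abs, sq_abs]
  nlinarith [norm_nonneg (m + s • x), sq_nonneg (‖m‖ - ‖s • x‖)]

lemma integrable_norm_sq_gauss (m : Param d) {v : ℝ} (hv : 0 < v) :
    Integrable (fun x : Param d => ‖x‖ ^ 2) (gauss m v) := by
  rw [gauss_eq_map m hv, integrable_map_measure (by fun_prop) (by fun_prop)]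
  refine Integrable.mono' ((integrable_const (2 * ‖m‖ ^ 2)).add
    (integrable_norm_sq_gauss_zero_one.const_mul (2 * √v ^ 2))) (by fun_prop)
    (Eventually.of_forall fun x => ?_)
  rw [Function.comp_apply, Real.norm_of_nonneg (by positivity)]
  exact norm_add_smul_sq_le m x _

/-! ### Entropy of laws with a density -/

section Density

variable {q : Param d → ENNReal}

lemma logDensity_ae (hq : Measurable q) :
    logDensity (volume.withDensity q) =ᵐ[volume.withDensity q] fun x => Real.log (q x).toReal := by
  refine (withDensity_absolutelyContinuous volume q).ae_eq ?_
  filter_upwards [Measure.rnDeriv_withDensity volume hq] with x hx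
  rw [logDensity, hx]

/-- A law whose density lies between a Gaussian and a constant has a finite entropy. -/
lemma integrable_logDensity (hq : Measurable q) [IsFiniteMeasure (volume.withDensity q)]
    (hm : Integrable (fun x : Param d => ‖x‖ ^ 2) (volume.withDensity q)) {a b c : ℝ}
    (ha : 0 < a) (hlo : ∀ x, a * Real.exp (-(b * ‖x‖ ^ 2)) ≤ (q x).toReal)
    (hhi : ∀ x, (q x).toReal ≤ c) :
    Integrable (logDensity (volume.withDensity q)) (volume.withDensity q) := by
  refine Integrable.congr ?_ (logDensity_ae hq).symm
  refine Integrable.mono' ((integrable_const (|Real.log a| + |Real.log c|)).add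
    (hm.const_mul |b|)) (hq.ennreal_toReal.log.aestronglyMeasurable)
    (Eventually.of_forall fun x => ?_)
  have h0 : 0 < a * Real.exp (-(b * ‖x‖ ^ 2)) := by positivity
  have h1 := Real.log_le_log h0 (hlo x)
  have h2 := Real.log_le_log (h0.trans_le (hlo x)) (hhi x)
  rw [Real.log_mul ha.ne' (Real.exp_pos _).ne', Real.log_exp] at h1
  have h3 : b * ‖x‖ ^ 2 ≤ |b| * ‖x‖ ^ 2 := by gcongr; exact le_abs_self b
  have h4 : 0 ≤ |b| * ‖x‖ ^ 2 := by positivity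
  simp only [Pi.add_apply]
  rw [Real.norm_eq_abs, abs_le]
  constructor
  · linarith [neg_abs_le (Real.log a), abs_nonneg (Real.log c)]
  · linarith [le_abs_self (Real.log c), abs_nonneg (Real.log a)]

lemma neg_log_le_shannon (hq : Measurable q) [IsProbabilityMeasure (volume.withDensity q)]
    (hi : Integrable (logDensity (volume.withDensity q)) (volume.withDensity q)) {c : ℝ}
    (hpos : ∀ x, 0 < (q x).toReal) (hhi : ∀ x, (q x).toReal ≤ c) :
    -Real.log c ≤ shannon (volume.withDensity q) := by
  refine neg_le_neg ?_
  have h := integral_mono_ae hi (integrable_const (Real.log c)) (by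
    filter_upwards [logDensity_ae hq] with x hx
    rw [hx]
    exact Real.log_le_log (hpos x) (hhi x))
  simpa using h

/-- The entropy is at most the cross entropy relative to the standard Gaussian. -/
lemma shannon_le (hq : Measurable q) [IsProbabilityMeasure (volume.withDensity q)]
    (hi : Integrable (logDensity (volume.withDensity q)) (volume.withDensity q))
    (hm : Integrable (fun x : Param d => ‖x‖ ^ 2) (volume.withDensity q))
    (hpos : ∀ x, 0 < (q x).toReal) :
    shannon (volume.withDensity q)
      ≤ d / 2 * Real.log (2 * Real.pi) + 1 / 2 * ∫ x, ‖x‖ ^ 2 ∂(volume.withDensity q) := by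
  have htop : ∀ x, q x < ⊤ := fun x => (ENNReal.toReal_pos_iff.1 (hpos x)).2
  have hloggauss : ∀ x : Param d, Real.log (gaussDensity 0 1 x)
      = -(d / 2 * Real.log (2 * Real.pi)) - 1 / 2 * ‖x‖ ^ 2 := fun x => by
    rw [gaussDensity_zero_one, Real.log_mul (by positivity) (Real.exp_pos _).ne',
      Real.log_rpow (by positivity), Real.log_exp]
    ring
  have hlog : Integrable (fun x => Real.log (q x).toReal) (volume.withDensity q) :=
    hi.congr (logDensity_ae hq)
  have hlg : Integrable (fun x => Real.log (gaussDensity 0 1 x)) (volume.withDensity q) := by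
    simp only [hloggauss]
    exact (integrable_const _).sub (hm.const_mul _)
  have hmass : ∫⁻ x, q x = 1 := by
    have := measure_univ (μ := volume.withDensity q)
    rwa [withDensity_apply _ MeasurableSet.univ, Measure.restrict_univ] at this
  have hqi : Integrable fun x => (q x).toReal :=
    integrable_toReal_of_lintegral_ne_top hq.aemeasurable (by simp [hmass])
  have hq1 : ∫ x, (q x).toReal = 1 := by
    rw [integral_toReal hq.aemeasurable (Eventually.of_forall htop), hmass, ENNReal.toReal_one]
  have hdiff := hlg.sub hlog
  have hdiff' :=
    (integrable_withDensity_iff_integrable_smul' hq (Eventually.of_forall htop)).1 hdiff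
  -- Gibbs' inequality: log t ≤ t - 1 at t = g/q gives q log(g/q) ≤ g - q, and both densities have
  -- mass one.
  have key : ∫ x, (Real.log (gaussDensity 0 1 x) - Real.log (q x).toReal) ∂(volume.withDensity q)
      ≤ 0 := by
    rw [integral_withDensity_eq_integral_toReal_smul hq (Eventually.of_forall htop)]
    have := integral_mono hdiff' (integrable_gaussDensity_zero_one.sub hqi) (fun x => by
      have hg := gaussDensity_pos (0 : Param d) one_pos x
      have h1 := Real.log_le_sub_one_of_pos (div_pos hg (hpos x))
      rw [Real.log_div hg.ne' (hpos x).ne'] at h1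
      have h2 := mul_le_mul_of_nonneg_left h1 (hpos x).le
      rw [mul_sub _ (_ / _), mul_one, mul_div_cancel₀ _ (hpos x).ne'] at h2
      simpa using h2)
    refine this.trans_eq ?_
    simp only [Pi.sub_apply]
    rw [integral_sub integrable_gaussDensity_zero_one hqi, integral_gaussDensity_zero_one, hq1,
      sub_self]
  rw [integral_sub hlg hlog] at key
  have hs : shannon (volume.withDensity q)
      = -∫ x, Real.log (q x).toReal ∂(volume.withDensity q) := by
    rw [shannon, integral_congr_ae (logDensity_ae hq)]
  have hg : ∫ x, Real.log (gaussDensity 0 1 x) ∂(volume.withDensity q)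
      = -(d / 2 * Real.log (2 * Real.pi)) - 1 / 2 * ∫ x, ‖x‖ ^ 2 ∂(volume.withDensity q) := by
    simp only [hloggauss]
    rw [integral_sub (integrable_const _) (hm.const_mul _), integral_const_mul]
    simp
  rw [hs]
  linarith

end Density


/-! ### Stochastic entropy -/

section Noise

variable {U : Param d → Param d} {Λ : NNReal}

lemma isProbabilityMeasure_jointLaw (μ : Param d) {τ : ℝ} (hτ : 0 < τ) :
    IsProbabilityMeasure (jointLaw μ τ) := by
  have := isProbabilityMeasure_gauss μ hτ
  unfold jointLaw
  infer_instance

lemma integrable_jointLaw_quadratic (μ : Param d) {τ : ℝ} (hτ : 0 < τ) (C : ℝ) :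
    Integrable (fun z : Param d × Param d => C * (1 + ‖z.1‖ ^ 2 + ‖z.2‖ ^ 2)) (jointLaw μ τ) := by
  have := isProbabilityMeasure_gauss μ hτ
  have h1 : Integrable (fun z : Param d × Param d => ‖z.1‖ ^ 2) (jointLaw μ τ) :=
    (integrable_norm_sq_gauss μ hτ).comp_fst _
  have h2 : Integrable (fun z : Param d × Param d => ‖z.2‖ ^ 2) (jointLaw μ τ) :=
    integrable_norm_sq_gauss_zero_one.comp_snd _
  have := isProbabilityMeasure_jointLaw μ hτ
  exact (((integrable_const 1).add h1).add h2).const_mul C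

lemma exists_linear_growth (hLip : LipschitzWith Λ U) :
    ∃ A : ℝ, 0 ≤ A ∧ ∀ x, ‖U x‖ ≤ A * (1 + ‖x‖) := by
  refine ⟨Λ + ‖U 0‖, by positivity, fun x => ?_⟩
  have l := hLip.dist_le_mul x 0
  rw [dist_eq_norm, dist_eq_norm, sub_zero] at l
  have a := norm_add_le (U x - U 0) (U 0)
  rw [sub_add_cancel] at a
  nlinarith [norm_nonneg x, norm_nonneg (U 0), Λ.coe_nonneg]

lemma sq_one_add_add_le (a b : ℝ) : (1 + a + b) ^ 2 ≤ 3 * (1 + a ^ 2 + b ^ 2) := by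
  nlinarith [sq_nonneg (a - b), sq_nonneg (1 - a), sq_nonneg (1 - b)]

lemma continuous_noisyUpdate (hU : Continuous U) (η σ : ℝ) : Continuous (noisyUpdate U η σ) := by
  unfold noisyUpdate update
  fun_prop

lemma norm_noisyUpdate_le (hLip : LipschitzWith Λ U) {η : ℝ} (hη : 0 < η) {S : ℝ} (hS : 0 ≤ S) :
    ∃ C : ℝ, 0 ≤ C ∧ ∀ σ, 0 ≤ σ → σ ≤ S → ∀ z : Param d × Param d,
      ‖noisyUpdate U η σ z‖ ≤ C * (1 + ‖z.1‖ + ‖z.2‖) := by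
  obtain ⟨A, hA, hUA⟩ := exists_linear_growth hLip
  refine ⟨1 + η * A + S, by positivity, fun σ h0 hσ z => ?_⟩
  have h1 : ‖noisyUpdate U η σ z‖ ≤ ‖z.1‖ + η * ‖U z.1‖ + σ * ‖z.2‖ := by
    unfold noisyUpdate update
    refine (norm_add_le _ _).trans ?_
    rw [norm_smul, Real.norm_of_nonneg h0]
    gcongr
    refine (norm_sub_le _ _).trans ?_
    rw [norm_smul, Real.norm_of_nonneg hη.le]
  have h2 : η * ‖U z.1‖ ≤ η * (A * (1 + ‖z.1‖)) := by gcongr; exact hUA _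
  have h3 : σ * ‖z.2‖ ≤ S * ‖z.2‖ := by gcongr
  have n1 := norm_nonneg z.1
  have n2 := norm_nonneg z.2
  nlinarith [mul_nonneg (mul_nonneg hη.le hA) n2, mul_nonneg hS n1]

/-- Both transition densities have variance σ², so the normalizations cancel and the residuals
remain: σε forward, η(U(θ_k) + U(θ_{k+1})) - σε backward. The right side is continuous in σ up to σ
= 0. -/
lemma sq_mul_bathEntropy (U : Param d → Param d) (η : ℝ) {σ : ℝ} (hσ : 0 < σ)
    (z : Param d × Param d) :
    σ ^ 2 * bathEntropy U η σ z
      = 1 / 2 * (‖η • (U z.1 + U (noisyUpdate U η σ z)) - σ • z.2‖ ^ 2 - ‖σ • z.2‖ ^ 2) := by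
  have hσ2 : 0 < σ ^ 2 := by positivity
  have hlog : ∀ m x : Param d, Real.log (gaussDensity m (σ ^ 2) x)
      = Real.log ((2 * Real.pi * σ ^ 2) ^ (-(d : ℝ) / 2)) + -‖x - m‖ ^ 2 / (2 * σ ^ 2) :=
    fun m x => by
      rw [gaussDensity, Real.log_mul (by positivity) (Real.exp_pos _).ne', Real.log_exp]
  rw [bathEntropy, transition, transition, Real.log_div (gaussDensity_pos _ hσ2 _).ne'
    (gaussDensity_pos _ hσ2 _).ne', hlog, hlog]
  have e1 : noisyUpdate U η σ z - update U η z.1 = σ • z.2 := by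
    simp [noisyUpdate]
  have e2 : z.1 - update U η (noisyUpdate U η σ z)
      = η • (U z.1 + U (noisyUpdate U η σ z)) - σ • z.2 := by
    rw [update]
    nth_rw 1 [noisyUpdate]
    rw [update]
    module
  rw [e1, e2]
  field_simp
  ring

/-- Linear growth of U gives a quadratic majorant uniform in σ ≤ S. It yields integrability with S =
σ and dominated convergence with S = 1. -/
lemma abs_sq_mul_bathEntropy_le (hLip : LipschitzWith Λ U) {η : ℝ} (hη : 0 < η) {S : ℝ}
    (hS : 0 ≤ S) : ∃ C : ℝ, ∀ σ, 0 < σ → σ ≤ S → ∀ z : Param d × Param d,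
      ‖σ ^ 2 * bathEntropy U η σ z‖ ≤ C * (1 + ‖z.1‖ ^ 2 + ‖z.2‖ ^ 2) := by
  obtain ⟨A, hA, hUA⟩ := exists_linear_growth hLip
  obtain ⟨D, hD, hN⟩ := norm_noisyUpdate_le hLip hη hS
  set c := η * (A + A * (1 + D)) + S with hc
  have hc0 : 0 ≤ c := by positivity
  refine ⟨1 / 2 * (c ^ 2 + c ^ 2) * 3, fun σ h0 hσ z => ?_⟩
  set n := 1 + ‖z.1‖ + ‖z.2‖ with hn
  have n1 := norm_nonneg z.1
  have n2 := norm_nonneg z.2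
  have hn1 : 1 ≤ n := by linarith
  have hs : ‖σ • z.2‖ ≤ S * n := by
    rw [norm_smul, Real.norm_of_nonneg h0.le]
    gcongr
    linarith
  have hs' : ‖σ • z.2‖ ≤ c * n := hs.trans (by
    gcongr
    exact le_add_of_nonneg_left (by positivity))
  have hu : ‖η • (U z.1 + U (noisyUpdate U η σ z))‖ ≤ η * (A * n + A * (n + D * n)) := by
    rw [norm_smul, Real.norm_of_nonneg hη.le]
    gcongr
    refine (norm_add_le _ _).trans (add_le_add ((hUA _).trans ?_) ((hUA _).trans ?_))
    · gcongr; linarith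
    · gcongr; exact hN σ h0.le hσ z
  have hd : ‖η • (U z.1 + U (noisyUpdate U η σ z)) - σ • z.2‖ ≤ c * n := by
    refine (norm_sub_le _ _).trans ((add_le_add hu hs).trans_eq ?_)
    rw [hc]; ring
  have q1 : ‖η • (U z.1 + U (noisyUpdate U η σ z)) - σ • z.2‖ ^ 2 ≤ c ^ 2 * n ^ 2 := by
    rw [← mul_pow]; gcongr
  have q2 : ‖σ • z.2‖ ^ 2 ≤ c ^ 2 * n ^ 2 := by
    rw [← mul_pow]; gcongr
  rw [sq_mul_bathEntropy U η h0, Real.norm_eq_abs]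
  have q3 := mul_le_mul_of_nonneg_left (sq_one_add_add_le ‖z.1‖ ‖z.2‖) (sq_nonneg c)
  rw [← hn] at q3
  rw [abs_le]
  constructor <;> nlinarith [sq_nonneg ‖σ • z.2‖,
    sq_nonneg ‖η • (U z.1 + U (noisyUpdate U η σ z)) - σ • z.2‖]

lemma measurable_bathEntropy (hU : Continuous U) (η σ : ℝ) :
    Measurable (bathEntropy U η σ) := by
  have hn := continuous_noisyUpdate hU η σ
  have h1 : Continuous fun z : Param d × Param d =>
      transition U η σ (noisyUpdate U η σ z) z.1 := by
    unfold transition gaussDensity update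
    fun_prop
  have h2 : Continuous fun z : Param d × Param d =>
      transition U η σ z.1 (noisyUpdate U η σ z) := by
    unfold transition gaussDensity update
    fun_prop
  exact (h1.measurable.div h2.measurable).log

lemma integrable_bathEntropy (hLip : LipschitzWith Λ U) {η σ : ℝ} (hη : 0 < η) (hσ : 0 < σ)
    (μ : Param d) {τ : ℝ} (hτ : 0 < τ) : Integrable (bathEntropy U η σ) (jointLaw μ τ) := by
  obtain ⟨C, hC⟩ := abs_sq_mul_bathEntropy_le hLip hη hσ.le
  have h : Integrable (fun z => σ ^ 2 * bathEntropy U η σ z) (jointLaw μ τ) :=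
    (integrable_jointLaw_quadratic μ hτ C).mono'
      ((measurable_bathEntropy hLip.continuous η σ).const_mul _).aestronglyMeasurable
      (Eventually.of_forall fun z => hC σ hσ le_rfl z)
  refine (h.const_mul (σ ^ 2)⁻¹).congr (Eventually.of_forall fun z => ?_)
  simp only
  rw [← mul_assoc, inv_mul_cancel₀ (by positivity), one_mul]

/-- The limit of `σ² ΔS_bath` as `σ → 0`. -/
def bathLimit (U : Param d → Param d) (η : ℝ) (θ : Param d) : ℝ :=
  1 / 2 * ‖η • (U θ + U (update U η θ))‖ ^ 2

lemma continuous_bathLimit (hU : Continuous U) (η : ℝ) : Continuous (bathLimit U η) := by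
  unfold bathLimit update
  fun_prop

lemma tendsto_sq_mul_bathEntropy (hU : Continuous U) (η : ℝ) (z : Param d × Param d) :
    Tendsto (fun σ => σ ^ 2 * bathEntropy U η σ z) (𝓝[>] 0) (𝓝 (bathLimit U η z.1)) := by
  have hc : Continuous fun σ : ℝ => 1 / 2 *
      (‖η • (U z.1 + U (noisyUpdate U η σ z)) - σ • z.2‖ ^ 2 - ‖σ • z.2‖ ^ 2) := by
    unfold noisyUpdate
    fun_prop
  have h := (hc.tendsto 0).mono_left (nhdsWithin_le_nhds (s := Set.Ioi 0))
  have e : 1 / 2 * (‖η • (U z.1 + U (noisyUpdate U η 0 z)) - (0 : ℝ) • z.2‖ ^ 2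
      - ‖(0 : ℝ) • z.2‖ ^ 2) = bathLimit U η z.1 := by
    simp [bathLimit, noisyUpdate]
  rw [e] at h
  refine h.congr' ?_
  filter_upwards [self_mem_nhdsWithin] with σ hσ
  rw [sq_mul_bathEntropy U η hσ]

lemma norm_bathLimit_le (hLip : LipschitzWith Λ U) {η : ℝ} (hη : 0 < η) :
    ∃ C : ℝ, 0 ≤ C ∧ ∀ θ, ‖bathLimit U η θ‖ ≤ C * (1 + ‖θ‖ ^ 2) := by
  obtain ⟨C, hC⟩ := abs_sq_mul_bathEntropy_le hLip hη zero_le_one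
  have h : ∀ θ, ‖bathLimit U η θ‖ ≤ C * (1 + ‖θ‖ ^ 2) := fun θ => by
    refine le_of_tendsto (tendsto_sq_mul_bathEntropy hLip.continuous η (θ, 0)).norm ?_
    filter_upwards [Ioc_mem_nhdsGT (zero_lt_one (α := ℝ))] with σ hσ
    simpa using hC σ hσ.1 hσ.2 (θ, 0)
  exact ⟨C, by simpa using (norm_nonneg _).trans (h 0), h⟩

lemma tendsto_integral_bathEntropy (hLip : LipschitzWith Λ U) {η : ℝ} (hη : 0 < η) (μ : Param d)
    {τ : ℝ} (hτ : 0 < τ) :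
    Tendsto (fun σ => σ ^ 2 * ∫ z, bathEntropy U η σ z ∂(jointLaw μ τ)) (𝓝[>] 0)
      (𝓝 (∫ θ, bathLimit U η θ ∂(gauss μ τ))) := by
  have := isProbabilityMeasure_gauss μ hτ
  obtain ⟨C, hC⟩ := abs_sq_mul_bathEntropy_le hLip hη zero_le_one
  have h : Tendsto (fun σ => ∫ z, σ ^ 2 * bathEntropy U η σ z ∂(jointLaw μ τ)) (𝓝[>] 0)
      (𝓝 (∫ z, bathLimit U η z.1 ∂(jointLaw μ τ))) := by
    refine tendsto_integral_filter_of_dominated_convergence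
      (fun z => C * (1 + ‖z.1‖ ^ 2 + ‖z.2‖ ^ 2)) ?_ ?_
      (integrable_jointLaw_quadratic μ hτ C)
      (Eventually.of_forall fun z => tendsto_sq_mul_bathEntropy hLip.continuous η z)
    · exact Eventually.of_forall fun σ =>
        ((measurable_bathEntropy hLip.continuous η σ).const_mul _).aestronglyMeasurable
    · filter_upwards [Ioc_mem_nhdsGT (zero_lt_one (α := ℝ))] with σ hσ
      exact Eventually.of_forall fun z => hC σ hσ.1 hσ.2 z
  have e : ∫ z, bathLimit U η z.1 ∂(jointLaw μ τ) = ∫ θ, bathLimit U η θ ∂(gauss μ τ) := by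
    rw [jointLaw, integral_fun_fst (bathLimit U η)]
    simp
  rw [e] at h
  simpa only [integral_const_mul] using h

/-- Writing each law as an image of the standard Gaussian moves τ from the measure into the
integrand, where dominated convergence applies. -/
lemma tendsto_integral_gauss {f : Param d → ℝ} (hf : Continuous f) {C : ℝ} (hC : 0 ≤ C)
    (hfC : ∀ x, ‖f x‖ ≤ C * (1 + ‖x‖ ^ 2)) (μ : Param d) :
    Tendsto (fun τ => ∫ x, f x ∂(gauss μ τ)) (𝓝[>] 0) (𝓝 (f μ)) := by
  have h : Tendsto (fun τ : ℝ => ∫ x, f (μ + √τ • x) ∂(gauss 0 1)) (𝓝[>] 0)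
      (𝓝 (∫ _, f μ ∂(gauss (0 : Param d) 1))) := by
    refine tendsto_integral_filter_of_dominated_convergence
      (fun x => C * (1 + (2 * ‖μ‖ ^ 2 + 2 * ‖x‖ ^ 2)))
      (Eventually.of_forall fun τ => (by fun_prop : Continuous _).aestronglyMeasurable) ?_ ?_ ?_
    · filter_upwards [Ioc_mem_nhdsGT (zero_lt_one (α := ℝ))] with τ hτ
      refine Eventually.of_forall fun x => (hfC _).trans ?_
      gcongr
      refine (norm_add_smul_sq_le μ x _).trans ?_
      rw [Real.sq_sqrt hτ.1.le]
      have := mul_le_mul_of_nonneg_right hτ.2 (sq_nonneg ‖x‖)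
      linarith
    · exact (((integrable_const _).add ((integrable_const _).add
        (integrable_norm_sq_gauss_zero_one.const_mul 2)))).const_mul C
    · refine Eventually.of_forall fun x => ?_
      have hc : Continuous fun τ : ℝ => f (μ + √τ • x) := by fun_prop
      have := (hc.tendsto 0).mono_left (nhdsWithin_le_nhds (s := Set.Ioi 0))
      simpa using this
  rw [integral_const, probReal_univ, one_smul] at h
  refine h.congr' ?_
  filter_upwards [self_mem_nhdsWithin] with τ hτ
  rw [gauss_eq_map μ hτ, integral_map (by fun_prop) hf.aestronglyMeasurable]

/-! ### The law of the next state and its Shannon entropy. -/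

/-- Density of the law of `θ_{k+1}`. -/
def nextDensity (U : Param d → Param d) (η σ : ℝ) (μ : Param d) (τ : ℝ) (x : Param d) : ENNReal :=
  ∫⁻ θ, ENNReal.ofReal (transition U η σ x θ) ∂(gauss μ τ)

lemma continuous_transition (hU : Continuous U) (η σ : ℝ) :
    Continuous fun p : Param d × Param d => transition U η σ p.1 p.2 := by
  unfold transition gaussDensity update
  fun_prop

lemma measurable_nextDensity (hU : Continuous U) (η σ : ℝ) (μ : Param d) {τ : ℝ} (hτ : 0 < τ) :
    Measurable (nextDensity U η σ μ τ) := by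
  have := isProbabilityMeasure_gauss μ hτ
  exact (continuous_transition hU η σ).measurable.ennreal_ofReal.lintegral_prod_right'

lemma lintegral_noisyUpdate (U : Param d → Param d) (η : ℝ) {σ : ℝ} (hσ : 0 < σ) (θ : Param d)
    {f : Param d → ENNReal} (hf : Measurable f) :
    ∫⁻ ε, f (noisyUpdate U η σ (θ, ε)) ∂(gauss 0 1)
      = ∫⁻ x, ENNReal.ofReal (transition U η σ x θ) * f x := by
  simp only [noisyUpdate, transition]
  rw [← lintegral_gauss_sq (update U η θ) hσ hf, gauss,
    lintegral_withDensity_eq_lintegral_mul _ (measurable_ofReal_gaussDensity _ _) hf]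
  simp only [Pi.mul_apply]

lemma nextLaw_eq (hU : Continuous U) (η : ℝ) {σ : ℝ} (hσ : 0 < σ) (μ : Param d) {τ : ℝ}
    (hτ : 0 < τ) : nextLaw U η σ μ τ = volume.withDensity (nextDensity U η σ μ τ) := by
  have := isProbabilityMeasure_gauss μ hτ
  have hn := (continuous_noisyUpdate hU η σ).measurable
  have hc := continuous_transition hU η σ
  refine Measure.ext_of_lintegral _ fun f hf => ?_
  have hswap : Measurable fun p : Param d × Param d =>
      ENNReal.ofReal (transition U η σ p.2 p.1) * f p.2 :=
    (hc.comp continuous_swap).measurable.ennreal_ofReal.mul (hf.comp measurable_snd)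
  have hx : ∀ x, Measurable fun θ => ENNReal.ofReal (transition U η σ x θ) := fun x =>
    (hc.comp (Continuous.prodMk_right x)).measurable.ennreal_ofReal
  rw [nextLaw, lintegral_map hf hn, jointLaw,
    lintegral_prod (fun z => f (noisyUpdate U η σ z)) (hf.comp hn).aemeasurable,
    lintegral_withDensity_eq_lintegral_mul _ (measurable_nextDensity hU η σ μ hτ) hf]
  simp only [lintegral_noisyUpdate U η hσ _ hf]
  rw [lintegral_lintegral_swap hswap.aemeasurable]
  simp only [lintegral_mul_const _ (hx _), nextDensity, Pi.mul_apply]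

lemma isProbabilityMeasure_nextLaw (hU : Continuous U) (η σ : ℝ) (μ : Param d) {τ : ℝ}
    (hτ : 0 < τ) : IsProbabilityMeasure (nextLaw U η σ μ τ) := by
  have := isProbabilityMeasure_jointLaw μ hτ
  exact Measure.isProbabilityMeasure_map (continuous_noisyUpdate hU η σ).aemeasurable

lemma nextDensity_le (U : Param d → Param d) (η : ℝ) {σ : ℝ} (hσ : 0 < σ) (μ : Param d) {τ : ℝ}
    (hτ : 0 < τ) (x : Param d) :
    nextDensity U η σ μ τ x ≤ ENNReal.ofReal ((2 * Real.pi * σ ^ 2) ^ (-(d : ℝ) / 2)) := by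
  have := isProbabilityMeasure_gauss μ hτ
  refine (lintegral_mono fun θ => ENNReal.ofReal_le_ofReal
    (gaussDensity_le (update U η θ) (by positivity : 0 < σ ^ 2) x)).trans ?_
  simp

lemma toReal_nextDensity_le (U : Param d → Param d) (η : ℝ) {σ : ℝ} (hσ : 0 < σ) (μ : Param d)
    {τ : ℝ} (hτ : 0 < τ) (x : Param d) :
    (nextDensity U η σ μ τ x).toReal ≤ (2 * Real.pi * σ ^ 2) ^ (-(d : ℝ) / 2) :=
  ENNReal.toReal_le_of_le_ofReal (by positivity) (nextDensity_le U η hσ μ hτ x)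

/-- Averaging `le_gaussDensity` over θ leaves a positive constant times a Gaussian in x, which
controls the log-density from below. -/
lemma le_nextDensity (hU : Continuous U) (η : ℝ) {σ : ℝ} (hσ : 0 < σ) (μ : Param d) {τ : ℝ}
    (hτ : 0 < τ) : ∃ a : ℝ, 0 < a ∧ ∀ x,
      a * Real.exp (-((σ ^ 2)⁻¹ * ‖x‖ ^ 2)) ≤ (nextDensity U η σ μ τ x).toReal := by
  have := isProbabilityMeasure_gauss μ hτ
  have hc : Continuous fun θ => Real.exp (-(‖update U η θ‖ ^ 2 / σ ^ 2)) := by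
    unfold update
    fun_prop
  have hi : Integrable (fun θ => Real.exp (-(‖update U η θ‖ ^ 2 / σ ^ 2))) (gauss μ τ) := by
    refine Integrable.mono' (integrable_const (1 : ℝ)) hc.aestronglyMeasurable
      (Eventually.of_forall fun θ => ?_)
    rw [Real.norm_of_nonneg (Real.exp_pos _).le, Real.exp_le_one_iff]
    exact neg_nonpos.2 (by positivity)
  have hpos := integral_exp_pos hi
  refine ⟨(2 * Real.pi * σ ^ 2) ^ (-(d : ℝ) / 2)
    * ∫ θ, Real.exp (-(‖update U η θ‖ ^ 2 / σ ^ 2)) ∂(gauss μ τ), by positivity, fun x => ?_⟩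
  refine (ENNReal.ofReal_le_iff_le_toReal
    ((nextDensity_le U η hσ μ hτ x).trans_lt ENNReal.ofReal_lt_top).ne).1 ?_
  have e : (2 * Real.pi * σ ^ 2) ^ (-(d : ℝ) / 2)
      * (∫ θ, Real.exp (-(‖update U η θ‖ ^ 2 / σ ^ 2)) ∂(gauss μ τ))
      * Real.exp (-((σ ^ 2)⁻¹ * ‖x‖ ^ 2))
      = ∫ θ, (2 * Real.pi * σ ^ 2) ^ (-(d : ℝ) / 2)
        * (Real.exp (-(‖update U η θ‖ ^ 2 / σ ^ 2)) * Real.exp (-((σ ^ 2)⁻¹ * ‖x‖ ^ 2)))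
        ∂(gauss μ τ) := by
    rw [integral_const_mul, integral_mul_const, mul_assoc]
  rw [e, ofReal_integral_eq_lintegral_ofReal ((hi.mul_const _).const_mul _)
    (Eventually.of_forall fun θ => by positivity)]
  exact lintegral_mono fun θ => ENNReal.ofReal_le_ofReal
    (le_gaussDensity (update U η θ) (by positivity) x)

lemma norm_noisyUpdate_sq_le (hLip : LipschitzWith Λ U) {η : ℝ} (hη : 0 < η) {S : ℝ}
    (hS : 0 ≤ S) : ∃ C : ℝ, ∀ σ, 0 ≤ σ → σ ≤ S → ∀ z : Param d × Param d,
      ‖noisyUpdate U η σ z‖ ^ 2 ≤ C * (1 + ‖z.1‖ ^ 2 + ‖z.2‖ ^ 2) := by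
  obtain ⟨C, hC0, hC⟩ := norm_noisyUpdate_le hLip hη hS
  refine ⟨C ^ 2 * 3, fun σ h0 hσ z => ?_⟩
  calc ‖noisyUpdate U η σ z‖ ^ 2 ≤ (C * (1 + ‖z.1‖ + ‖z.2‖)) ^ 2 := by
        gcongr; exact hC σ h0 hσ z
    _ = C ^ 2 * (1 + ‖z.1‖ + ‖z.2‖) ^ 2 := by ring
    _ ≤ C ^ 2 * (3 * (1 + ‖z.1‖ ^ 2 + ‖z.2‖ ^ 2)) := by
        gcongr; exact sq_one_add_add_le _ _
    _ = _ := by ring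

lemma integrable_norm_noisyUpdate_sq (hLip : LipschitzWith Λ U) {η σ : ℝ} (hη : 0 < η)
    (hσ : 0 < σ) (μ : Param d) {τ : ℝ} (hτ : 0 < τ) :
    Integrable (fun z => ‖noisyUpdate U η σ z‖ ^ 2) (jointLaw μ τ) := by
  obtain ⟨C, hC⟩ := norm_noisyUpdate_sq_le hLip hη hσ.le
  refine (integrable_jointLaw_quadratic μ hτ C).mono'
    ((continuous_noisyUpdate hLip.continuous η σ).norm.pow 2).aestronglyMeasurable
    (Eventually.of_forall fun z => ?_)
  rw [Real.norm_of_nonneg (by positivity)]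
  exact hC σ hσ.le le_rfl z

lemma integrable_norm_sq_nextLaw (hLip : LipschitzWith Λ U) {η σ : ℝ} (hη : 0 < η)
    (hσ : 0 < σ) (μ : Param d) {τ : ℝ} (hτ : 0 < τ) :
    Integrable (fun x : Param d => ‖x‖ ^ 2) (nextLaw U η σ μ τ) := by
  rw [nextLaw, integrable_map_measure (by fun_prop)
    (continuous_noisyUpdate hLip.continuous η σ).aemeasurable]
  exact integrable_norm_noisyUpdate_sq hLip hη hσ μ hτ

lemma integral_norm_sq_nextLaw_le (hLip : LipschitzWith Λ U) {η : ℝ} (hη : 0 < η) (μ : Param d)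
    {τ : ℝ} (hτ : 0 < τ) : ∃ M : ℝ, ∀ σ, 0 < σ → σ ≤ 1 →
      ∫ x, ‖x‖ ^ 2 ∂(nextLaw U η σ μ τ) ≤ M := by
  obtain ⟨C, hC⟩ := norm_noisyUpdate_sq_le hLip hη zero_le_one
  refine ⟨∫ z, C * (1 + ‖z.1‖ ^ 2 + ‖z.2‖ ^ 2) ∂(jointLaw μ τ), fun σ h0 hσ => ?_⟩
  rw [nextLaw, integral_map (continuous_noisyUpdate hLip.continuous η σ).aemeasurable
    (by fun_prop)]
  exact integral_mono (integrable_norm_noisyUpdate_sq hLip hη h0 μ hτ)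
    (integrable_jointLaw_quadratic μ hτ C) (hC σ h0.le hσ)

lemma integrable_logDensity_nextLaw (hLip : LipschitzWith Λ U) {η σ : ℝ} (hη : 0 < η)
    (hσ : 0 < σ) (μ : Param d) {τ : ℝ} (hτ : 0 < τ) :
    Integrable (logDensity (nextLaw U η σ μ τ)) (nextLaw U η σ μ τ) := by
  have hp := isProbabilityMeasure_nextLaw hLip.continuous η σ μ hτ
  have hm := integrable_norm_sq_nextLaw hLip hη hσ μ hτ
  rw [nextLaw_eq hLip.continuous η hσ μ hτ] at hp hm ⊢
  obtain ⟨a, ha, hlo⟩ := le_nextDensity hLip.continuous η hσ μ hτ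
  exact integrable_logDensity (measurable_nextDensity hLip.continuous η σ μ hτ) hm ha hlo
    (toReal_nextDensity_le U η hσ μ hτ)

lemma integrable_logDensity_gauss (μ : Param d) {τ : ℝ} (hτ : 0 < τ) :
    Integrable (logDensity (gauss μ τ)) (gauss μ τ) := by
  have hp := isProbabilityMeasure_gauss μ hτ
  have hm := integrable_norm_sq_gauss μ hτ
  have e : ∀ x, (ENNReal.ofReal (gaussDensity μ τ x)).toReal = gaussDensity μ τ x := fun x =>
    ENNReal.toReal_ofReal (gaussDensity_pos μ hτ x).le
  rw [gauss] at hp hm ⊢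
  refine integrable_logDensity (a := (2 * Real.pi * τ) ^ (-(d : ℝ) / 2)
    * Real.exp (-(‖μ‖ ^ 2 / τ))) (b := τ⁻¹) (measurable_ofReal_gaussDensity μ τ) hm
    (by positivity) (fun x => ?_) (fun x => (e x).trans_le (gaussDensity_le μ hτ x))
  rw [e, mul_assoc]
  exact le_gaussDensity μ hτ x

lemma entropyWellDefined (hLip : LipschitzWith Λ U) {η σ : ℝ} (hη : 0 < η) (hσ : 0 < σ)
    (μ : Param d) {τ : ℝ} (hτ : 0 < τ) : EntropyWellDefined U η σ μ τ where
  init_prob := isProbabilityMeasure_gauss μ hτ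
  next_prob := isProbabilityMeasure_nextLaw hLip.continuous η σ μ hτ
  next_ac := by
    rw [nextLaw_eq hLip.continuous η hσ μ hτ]
    exact withDensity_absolutelyContinuous _ _
  bath := integrable_bathEntropy hLip hη hσ μ hτ
  sys_init := integrable_logDensity_gauss μ hτ
  sys_next := integrable_logDensity_nextLaw hLip hη hσ μ hτ

/-- The density is at most (2πσ²)^(-d/2), which bounds the entropy below. The second moment is
bounded uniformly in σ ≤ 1, which bounds it above. Such crude bounds suffice because of the factor
σ². -/
lemma shannon_nextLaw_bounds (hLip : LipschitzWith Λ U) {η : ℝ} (hη : 0 < η) (μ : Param d)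
    {τ : ℝ} (hτ : 0 < τ) : ∃ M : ℝ, ∀ σ, 0 < σ → σ ≤ 1 →
      d / 2 * Real.log (2 * Real.pi * σ ^ 2) ≤ shannon (nextLaw U η σ μ τ) ∧
      shannon (nextLaw U η σ μ τ) ≤ M := by
  obtain ⟨M, hM⟩ := integral_norm_sq_nextLaw_le hLip hη μ hτ
  refine ⟨d / 2 * Real.log (2 * Real.pi) + 1 / 2 * M, fun σ hσ hσ1 => ?_⟩
  have hp := isProbabilityMeasure_nextLaw hLip.continuous η σ μ hτ
  have hm := integrable_norm_sq_nextLaw hLip hη hσ μ hτ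
  have hi := integrable_logDensity_nextLaw hLip hη hσ μ hτ
  have hMσ := hM σ hσ hσ1
  rw [nextLaw_eq hLip.continuous η hσ μ hτ] at hp hm hi hMσ ⊢
  have hq := measurable_nextDensity hLip.continuous η σ μ hτ
  obtain ⟨a, ha, hlo⟩ := le_nextDensity hLip.continuous η hσ μ hτ
  have hpos : ∀ x, 0 < (nextDensity U η σ μ τ x).toReal := fun x =>
    (mul_pos ha (Real.exp_pos _)).trans_le (hlo x)
  refine ⟨?_, (shannon_le hq hi hm hpos).trans (by linarith)⟩
  have := neg_log_le_shannon hq hi hpos (toReal_nextDensity_le U η hσ μ hτ)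
  rw [Real.log_rpow (by positivity)] at this
  linarith [(by ring : -(-(d : ℝ) / 2 * Real.log (2 * Real.pi * σ ^ 2))
    = d / 2 * Real.log (2 * Real.pi * σ ^ 2))]

lemma tendsto_sq_mul_shannon_nextLaw (hLip : LipschitzWith Λ U) {η : ℝ} (hη : 0 < η)
    (μ : Param d) {τ : ℝ} (hτ : 0 < τ) :
    Tendsto (fun σ => σ ^ 2 * shannon (nextLaw U η σ μ τ)) (𝓝[>] 0) (𝓝 0) := by
  obtain ⟨M, hM⟩ := shannon_nextLaw_bounds hLip hη μ hτ
  have hlo : Tendsto (fun σ : ℝ => σ ^ 2 * (d / 2 * Real.log (2 * Real.pi * σ ^ 2))) (𝓝[>] 0)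
      (𝓝 0) := by
    -- With t = 2πσ² the expression is d/(4π) times t log t, which is continuous with value 0 at t =
    -- 0.
    have hc : Continuous fun σ : ℝ => d / (4 * Real.pi)
        * ((2 * Real.pi * σ ^ 2) * Real.log (2 * Real.pi * σ ^ 2)) :=
      (Real.continuous_mul_log.comp
        (by fun_prop : Continuous fun σ : ℝ => 2 * Real.pi * σ ^ 2)).const_mul _
    have := (hc.tendsto 0).mono_left (nhdsWithin_le_nhds (s := Set.Ioi 0))
    simp only [ne_eq, OfNat.ofNat_ne_zero, not_false_eq_true, zero_pow, mul_zero, zero_mul] at this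
    refine this.congr fun σ => ?_
    have := Real.pi_pos
    field_simp
    ring
  have hhi : Tendsto (fun σ : ℝ => σ ^ 2 * M) (𝓝[>] 0) (𝓝 0) := by
    have hc : Continuous fun σ : ℝ => σ ^ 2 * M := by fun_prop
    simpa using (hc.tendsto 0).mono_left (nhdsWithin_le_nhds (s := Set.Ioi 0))
  refine tendsto_of_tendsto_of_tendsto_of_le_of_le' hlo hhi ?_ ?_
  · filter_upwards [Ioc_mem_nhdsGT (zero_lt_one (α := ℝ))] with σ hσ
    exact mul_le_mul_of_nonneg_left (hM σ hσ.1 hσ.2).1 (sq_nonneg σ)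
  · filter_upwards [Ioc_mem_nhdsGT (zero_lt_one (α := ℝ))] with σ hσ
    exact mul_le_mul_of_nonneg_left (hM σ hσ.1 hσ.2).2 (sq_nonneg σ)

/-- The system entropy disappears in the limit σ → 0 and the bath leaves a Gaussian average of
`bathLimit`, which concentrates at μ as τ → 0. The limit is exact for every η > 0. -/
lemma hasScaledEntropyProduction (hLip : LipschitzWith Λ U) {η : ℝ} (hη : 0 < η) (μ : Param d) :
    HasScaledEntropyProduction U η μ (bathLimit U η μ) := by
  refine ⟨fun τ σ hτ hσ => entropyWellDefined hLip hη hσ μ hτ,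
    fun τ => ∫ θ, bathLimit U η θ ∂(gauss μ τ), fun τ hτ => ?_, ?_⟩
  · have h3 : Tendsto (fun σ : ℝ => σ ^ 2 * shannon (gauss μ τ)) (𝓝[>] 0) (𝓝 0) := by
      have hc : Continuous fun σ : ℝ => σ ^ 2 * shannon (gauss μ τ) := by fun_prop
      simpa using (hc.tendsto 0).mono_left (nhdsWithin_le_nhds (s := Set.Ioi 0))
    have := (tendsto_integral_bathEntropy hLip hη μ hτ).add
      ((tendsto_sq_mul_shannon_nextLaw hLip hη μ hτ).sub h3)
    rw [sub_zero, add_zero] at this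
    refine this.congr fun σ => ?_
    rw [meanTotalEntropy]
    ring
  · obtain ⟨C, hC, h⟩ := norm_bathLimit_le hLip hη
    exact tendsto_integral_gauss (continuous_bathLimit hLip.continuous η) hC h μ

end Noise

lemma HasScaledEntropyProduction.unique {U : Param d → Param d} {η : ℝ} {μ : Param d} {L L' : ℝ}
    (h : HasScaledEntropyProduction U η μ L) (h' : HasScaledEntropyProduction U η μ L') :
    L = L' := by
  obtain ⟨-, l, hl, hL⟩ := h
  obtain ⟨-, l', hl', hL'⟩ := h'
  refine tendsto_nhds_unique hL (hL'.congr' ?_)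
  filter_upwards [self_mem_nhdsWithin] with τ hτ
  exact tendsto_nhds_unique (hl' τ hτ) (hl τ hτ)

/-- With w = U(Φθ) - U(θ) = O(η), the limit is ½η²‖2U + w‖² = 2η²‖U‖² + O(η³), and 2η²‖U‖² is 8η
times (η/4)‖U‖². Only the Lipschitz bound on w is needed. -/
lemma bathLimit_expansion {U : Param d → Param d} (hU : ContDiff ℝ 2 U) {Λ : NNReal}
    (hLip : LipschitzWith Λ U) :
    LocO 3 fun η μ => bathLimit U η μ - 8 * η * leading U η μ := by
  refine locO_of_ball fun R _ => ?_
  obtain ⟨B, hB⟩ := exists_bound_on_ball hU.continuous R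
  refine ⟨1 / 2 * (Λ * B * (4 * B + Λ * B)), 1, one_pos, fun η h1 h2 θ hθ => ?_⟩
  have hUθ := hB θ hθ
  have hB0 : 0 ≤ B := (norm_nonneg _).trans hUθ
  set w := U (update U η θ) - U θ with hw
  have hwn : ‖w‖ ≤ η * (Λ * B) := by
    have l := hLip.dist_le_mul (update U η θ) θ
    have e : update U η θ - θ = -(η • U θ) := by rw [update]; abel
    rw [dist_eq_norm, dist_eq_norm, e, norm_neg, norm_smul, Real.norm_of_nonneg h1.le] at l
    refine l.trans ?_
    calc Λ * (η * ‖U θ‖) ≤ Λ * (η * B) := by gcongr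
      _ = _ := by ring
  have hwn' : ‖w‖ ≤ Λ * B := hwn.trans (mul_le_of_le_one_left (by positivity) h2.le)
  have e : bathLimit U η θ - 8 * η * leading U η θ
      = 1 / 2 * η ^ 2 * (4 * inner ℝ (U θ) w + ‖w‖ ^ 2) := by
    have e1 : U θ + U (update U η θ) = (2 : ℝ) • U θ + w := by rw [hw]; module
    rw [bathLimit, leading, e1, norm_smul, mul_pow, norm_add_sq_real, norm_smul,
      real_inner_smul_left, Real.norm_ofNat, Real.norm_eq_abs, sq_abs]
    ring
  rw [e, norm_mul, Real.norm_of_nonneg (by positivity)]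
  have hi := abs_real_inner_le_norm (U θ) w
  have hin : ‖4 * inner ℝ (U θ) w + ‖w‖ ^ 2‖ ≤ ‖w‖ * (4 * B + Λ * B) := by
    have a : ‖U θ‖ * ‖w‖ ≤ B * ‖w‖ := by gcongr
    have b : ‖w‖ * ‖w‖ ≤ Λ * B * ‖w‖ := by gcongr
    rw [Real.norm_eq_abs, abs_le]
    constructor <;> nlinarith [abs_le.1 hi, sq_nonneg ‖w‖]
  calc 1 / 2 * η ^ 2 * _ ≤ 1 / 2 * η ^ 2 * (η * (Λ * B) * (4 * B + Λ * B)) := by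
        refine mul_le_mul_of_nonneg_left (hin.trans ?_) (by positivity)
        gcongr
    _ = _ := by ring

lemma isSTPotential_leading {U : Param d → Param d} (hU : ContDiff ℝ 2 U) {Λ : NNReal}
    (hLip : LipschitzWith Λ U) : IsSTPotential U (leading U) :=
  ⟨bathLimit U, fun _ hη μ => hasScaledEntropyProduction hLip hη μ, bathLimit_expansion hU hLip⟩

lemma IsSTPotential.eqLeading {U : Param d → Param d} (hU : ContDiff ℝ 2 U) {Λ : NNReal}
    (hLip : LipschitzWith Λ U) {φ : ℝ → Param d → ℝ} (h : IsSTPotential U φ) :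
    EqLeading U φ := by
  obtain ⟨L, hL, hO⟩ := h
  refine LocO.of_smul ?_
  -- The iterated limit is unique, so L is `bathLimit`. It fixes the value of φ_η and not only its
  -- gradient, hence no free constant.
  refine (((bathLimit_expansion hU hLip).add hO.neg).const_smul (1 / 8)).congr fun η hη μ => ?_
  rw [(hL η hη μ).unique (hasScaledEntropyProduction hLip hη μ)]
  simp only [smul_eq_mul]
  ring

end Irrev

end

theorem mainTheorem1 {d : ℕ} (U : Irrev.Param d → Irrev.Param d) (hU : ContDiff ℝ 2 U)
    (Λ : NNReal) (hLip : LipschitzWith Λ U) (hsym : Irrev.SymmetricJacobian U) :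
    -- discretization error
    (Irrev.IsDEPotential U (Irrev.leading U) ∧
      ∀ φ : ℝ → Irrev.Param d → ℝ, Irrev.IsDEPotential U φ → Irrev.EqLeadingUpToConst U φ) ∧
    -- time reversal asymmetry
    (Irrev.IsTAPotential U (Irrev.leading U) ∧
      (∀ φ : ℝ → Irrev.Param d → ℝ, Irrev.IsTAPotential U φ → Irrev.EqLeadingUpToConst U φ) ∧
      ∀ θref : Irrev.Param d,
        Irrev.EqLeading U fun η θ =>
          Irrev.taLinePotential U θref η θ + Irrev.leading U η θref) ∧
    -- time renormalization
    ((∃ V : ℝ → ℕ → Irrev.Param d → Irrev.Param d, Irrev.IsRefinement U V ∧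
        ∀ η : ℝ, 0 < η → ∀ k, Irrev.SymmetricJacobian (V η k)) ∧
      ∀ V : ℝ → ℕ → Irrev.Param d → Irrev.Param d, Irrev.IsRefinement U V →
        Irrev.IsTRPotential U V (Irrev.leading U) ∧
        ∀ φ : ℝ → Irrev.Param d → ℝ, Irrev.IsTRPotential U V φ →
          Irrev.EqLeadingUpToConst U φ) ∧
    -- stochastic entropy
    (Irrev.IsSTPotential U (Irrev.leading U) ∧
      ∀ φ : ℝ → Irrev.Param d → ℝ, Irrev.IsSTPotential U φ → Irrev.EqLeading U φ) := by
  exact ⟨⟨Irrev.isDEPotential_leading hU hLip hsym, fun _ h => h.eqLeading hU hsym⟩,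
    ⟨Irrev.isTAPotential_leading hU hsym, fun _ h => h.eqLeading hU hsym,
      Irrev.taLinePotential_eqLeading hU hsym⟩,
    ⟨Irrev.exists_symmetric_refinement hU hLip hsym, fun _ hV =>
      ⟨hV.isTRPotential_leading hU hsym, fun _ h => h.eqLeading hU hsym hV⟩⟩,
    Irrev.isSTPotential_leading hU hLip, fun _ h => h.eqLeading hU hLip⟩
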